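/- For a finite graph $G$, let $r(G)$ be its Ramsey number, the smallest integer $N$ such that every $2$-colouring of the edges of the complete graph on $N$ vertices contains a monochromatic copy of $G$. Let $nH$ denote the vertex-disjoint union of $n$ copies of a graph $H$, let $|H|$ be the number of vertices of $H$, and let $\alpha(H)$ be the largest size of an independent set in $H$. There is an absolute constant $C>0$ such that for every integer $k\ge 0$ and every $k$-vertex graph $H$ without isolated vertices there is a constant $c=c(H)$ (an integer depending only on $H$) such that $$r(nH)=(2|H|-\alpha(H))\,n+c(H)\qquad\text{for all integers } n\ge 2^{Ck}.$$ -/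

import Mathlib

/-- The disjoint union `nH` of `n` copies of `H`; the vertex `(i, v)` is the vertex `v` of the
`i`-th copy. -/
def copies {V : Type*} (n : ℕ) (H : SimpleGraph V) : SimpleGraph (Fin n × V) where
  Adj x y := x.1 = y.1 ∧ H.Adj x.2 y.2
  symm := ⟨fun _ _ h => ⟨h.1.symm, h.2.symm⟩⟩
  loopless := ⟨fun _ h => H.irrefl h.2⟩

/-- `RamseyProperty N G`: every colouring of the edges of the complete graph on `N` vertices
with two colours contains a monochromatic copy of `G`, as a not necessarily induced subgraph.
Here `χ.labelGraph i` is the graph formed by the edges of colour `i`. -/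
def RamseyProperty {W : Type*} (N : ℕ) (G : SimpleGraph W) : Prop :=
  ∀ χ : SimpleGraph.TopEdgeLabeling (Fin N) (Fin 2), ∃ i : Fin 2,
    SimpleGraph.IsContained G (χ.labelGraph i)

/-- The Ramsey number `r(G)` of a (finite) graph `G`: the smallest order `N` of a complete graph
such that every 2-colouring of its edges contains a monochromatic copy of `G`. -/
noncomputable def ramseyNumber {W : Type*} (G : SimpleGraph W) : ℕ :=
  sInf {N : ℕ | RamseyProperty N G}

/-! Write k = |H|, α = α(H), s = k − α, q = 2^k; a colouring is a graph G together with its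
complement. A core is H minus an independent set, so it has at least s vertices. The proof shows
r(nH) = kn + `coreNumber H n` for n ≥ q^24, and that `coreNumber H` grows by exactly s per step from
q^14 on.

Lower bound (`not_ramseyProperty_copies`): put a G-clique on kn − 1 vertices beside an extremal
core-avoiding colouring, with all edges between them in Gᶜ. A G-copy of H that leaves the clique
puts a closed part on the other side, which is excluded, and n copies do not fit in the clique. A
Gᶜ-copy meets the clique in an independent set of H, so n disjoint copies would leave n disjoint
cores on the other side.

Upper bound (`pack_hosts_of_card`): suppose neither colour packs n copies. A bowtie supplies one
copy in each colour for k + s vertices, exactly the rate of the claimed bound, so bowties may be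
deleted; a bowtie-free set is almost perfectly packed by one colour. Hence no large set K can beat
the bowtie rate in both colours at once. Deleting monochromatic k-cliques greedily gives large
disjoint R and B, where R has no k-clique of Gᶜ and B none of G. Many disjoint links in both
directions would form such a K. Otherwise, up to swapping colours, there are no links from R to B
after losing few vertices. Then an absorber in R with a piece of B forms a K that almost attains the
bowtie rate, so few vertices survive outside it. Either the absorber completes enough survivors to
G-copies, or the survivors and the piece of B contain the required number of Gᶜ-cores by the
definition of `coreNumber`, and these extend into the absorber.

Recurrence (`coreNumber_succ`): deleting an s-clique of Gᶜ lowers n by one. Conversely, all but a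
few vertices of an extremal colouring can be replaced by one Gᶜ-clique with s extra vertices; an
absorber for s-cliques of Gᶜ makes the count exact. -/

set_option linter.unusedSectionVars false

section
open Classical Finset

/-! ### Packings of disjoint sets -/

/-- `Pack P n X`: the finset `X` contains `n` pairwise disjoint subsets satisfying `P`. -/
def Pack {α : Type*} (P : Finset α → Prop) (n : ℕ) (X : Finset α) : Prop :=
  ∃ F : Fin n → Finset α, Pairwise (fun i j => Disjoint (F i) (F j)) ∧ ∀ i, F i ⊆ X ∧ P (F i)

variable {α : Type*} [DecidableEq α] {P Q : Finset α → Prop} {X Y : Finset α}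

theorem Pack.zero : Pack P 0 X := ⟨fun _ => ∅, fun i => i.elim0, fun i => i.elim0⟩

theorem Pack.mono_set {n : ℕ} (h : Pack P n X) (hXY : X ⊆ Y) : Pack P n Y := by
  obtain ⟨F, h1, h2⟩ := h
  exact ⟨F, h1, fun i => ⟨(h2 i).1.trans hXY, (h2 i).2⟩⟩

theorem Pack.of_le {m n : ℕ} (h : Pack P n X) (hmn : m ≤ n) : Pack P m X := by
  obtain ⟨F, h1, h2⟩ := h
  refine ⟨fun i => F (Fin.castLE hmn i), fun i j hij => h1 ?_, fun i => h2 _⟩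
  exact fun h => hij (Fin.castLE_injective hmn h)

theorem Pack.imp {n : ℕ} (h : Pack P n X) (hPQ : ∀ Y ⊆ X, P Y → ∃ Z ⊆ Y, Q Z) : Pack Q n X := by
  obtain ⟨F, h1, h2⟩ := h
  choose G hG hQ using fun i => hPQ (F i) (h2 i).1 (h2 i).2
  exact ⟨G, fun i j hij => (h1 hij).mono (hG i) (hG j), fun i => ⟨(hG i).trans (h2 i).1, hQ i⟩⟩

theorem pack_of_family {ι : Type*} (T : Finset ι) (F : ι → Finset α)
    (hd : ∀ i ∈ T, ∀ j ∈ T, i ≠ j → Disjoint (F i) (F j)) (hF : ∀ i ∈ T, F i ⊆ X ∧ P (F i)) :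
    Pack P T.card X := by
  refine ⟨fun i => F (T.equivFin.symm i), fun i j hij => hd _ (T.equivFin.symm i).2 _
    (T.equivFin.symm j).2 fun h => hij ?_, fun i => hF _ (T.equivFin.symm i).2⟩
  exact T.equivFin.symm.injective (Subtype.ext h)

theorem Pack.union {m n : ℕ} (h1 : Pack P m X) (h2 : Pack P n Y) (hd : Disjoint X Y) :
    Pack P (m + n) (X ∪ Y) := by
  obtain ⟨F, hF, hF'⟩ := h1
  obtain ⟨G, hG, hG'⟩ := h2
  have := pack_of_family (P := P) (X := X ∪ Y) (univ : Finset (Fin m ⊕ Fin n)) (Sum.elim F G) ?_ ?_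
  · simpa using this
  · rintro (i | i) - (j | j) - hij
    · exact hF (by simpa using hij)
    · exact hd.mono (hF' i).1 (hG' j).1
    · exact (hd.mono (hF' j).1 (hG' i).1).symm
    · exact hG (by simpa using hij)
  · rintro (i | i) -
    · exact ⟨(hF' i).1.trans subset_union_left, (hF' i).2⟩
    · exact ⟨(hG' i).1.trans subset_union_right, (hG' i).2⟩

theorem Pack.one (h : P X) : Pack P 1 X :=
  ⟨fun _ => X, fun i j hij => (hij (Subsingleton.elim i j)).elim, fun _ => ⟨Subset.rfl, h⟩⟩

theorem Pack.mul {m n : ℕ} (h : Pack P n X) (hPQ : ∀ Y ⊆ X, P Y → Pack Q m Y) :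
    Pack Q (n * m) X := by
  obtain ⟨F, hF, hF'⟩ := h
  choose G hG hG' using fun i => hPQ (F i) (hF' i).1 (hF' i).2
  have := pack_of_family (P := Q) (X := X) (univ : Finset (Fin n × Fin m)) (fun x => G x.1 x.2) ?_ ?_
  · simpa using this
  · rintro ⟨i, i'⟩ - ⟨j, j'⟩ - hij
    by_cases h : i = j
    · subst h
      exact hG i (fun h => hij (Prod.ext rfl h))
    · exact (hF h).mono (hG' _ _).1 (hG' _ _).1
  · rintro ⟨i, i'⟩ -
    exact ⟨(hG' _ _).1.trans (hF' i).1, (hG' _ _).2⟩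

theorem Pack.mul_le_card {n c : ℕ} (h : Pack P n X) (hc : ∀ Y, P Y → c ≤ Y.card) :
    c * n ≤ X.card := by
  obtain ⟨F, hF, hF'⟩ := h
  have h1 : (univ.biUnion F).card = ∑ i, (F i).card :=
    card_biUnion fun i _ j _ hij => hF hij
  have h2 : (univ.biUnion F).card ≤ X.card :=
    card_le_card (biUnion_subset.2 fun i _ => (hF' i).1)
  have h3 : ∑ _i : Fin n, c ≤ ∑ i, (F i).card := sum_le_sum fun i _ => hc _ (hF' i).2
  simp at h3
  rw [mul_comm]; omega

/-- Removing disjoint `P`-sets of size `a` as long as possible. -/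
theorem exists_pack_leftover (a : ℕ) (ha : 0 < a) (hP : ∀ Y, P Y → Y.card = a) (X : Finset α) :
    ∃ j, ∃ Y ⊆ X, (∀ Z ⊆ Y, ¬ P Z) ∧ Pack P j (X \ Y) ∧ X.card = a * j + Y.card := by
  induction' hn : X.card using Nat.strong_induction_on with n ih generalizing X
  by_cases h : ∃ Z ⊆ X, P Z
  · obtain ⟨Z, hZ, hPZ⟩ := h
    have hc := card_sdiff_add_card_eq_card hZ
    have hZa := hP Z hPZ
    obtain ⟨j, Y, hY, hY1, hY2, hY3⟩ := ih (X \ Z).card (by omega) (X \ Z) rfl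
    refine ⟨j + 1, Y, hY.trans sdiff_subset, hY1, ?_, by rw [mul_add]; omega⟩
    refine (hY2.union (Pack.one hPZ) ?_).mono_set ?_
    · exact disjoint_of_subset_left sdiff_subset sdiff_disjoint
    · intro x hx
      simp only [mem_union, mem_sdiff] at hx ⊢
      rcases hx with hx | hx
      · tauto
      · exact ⟨hZ hx, fun h => (mem_sdiff.1 (hY h)).2 hx⟩
  · push Not at h
    exact ⟨0, X, Subset.rfl, h, Pack.zero, by omega⟩

theorem pack_or_exists_free (c : ℕ) (hP : ∀ Y, P Y → Y.card ≤ c) (x : ℕ) (X : Finset α) :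
    Pack P x X ∨ ∃ Y ⊆ X, X.card ≤ Y.card + c * x ∧ ∀ Z ⊆ Y, ¬ P Z := by
  induction x generalizing X with
  | zero => exact Or.inl Pack.zero
  | succ x ih =>
    by_cases h : ∃ Z ⊆ X, P Z
    · obtain ⟨Z, hZ, hPZ⟩ := h
      have hc := card_sdiff_add_card_eq_card hZ
      have := hP Z hPZ
      rcases ih (X \ Z) with h | ⟨Y, hY, hY1, hY2⟩
      · left
        refine (h.union (Pack.one hPZ) sdiff_disjoint).mono_set ?_
        exact union_subset sdiff_subset hZ
      · exact Or.inr ⟨Y, hY.trans sdiff_subset, by rw [mul_add]; omega, hY2⟩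
    · push Not at h
      exact Or.inr ⟨X, Subset.rfl, by omega, h⟩

/-- Greedy choice of disjoint sets of bounded size. -/
theorem exists_disjoint_family {ι : Type*} (T : Finset ι) (R : ι → Finset α → Prop) (c : ℕ)
    (h : ∀ i ∈ T, ∀ Y : Finset α, Y.card ≤ c * T.card → ∃ C, R i C ∧ C.card ≤ c ∧ Disjoint C Y) :
    ∃ C : ι → Finset α, (∀ i ∈ T, R i (C i)) ∧
      ∀ i ∈ T, ∀ j ∈ T, i ≠ j → Disjoint (C i) (C j) := by
  suffices H : ∀ S ⊆ T, ∃ C : ι → Finset α, (∀ i ∈ S, R i (C i) ∧ (C i).card ≤ c) ∧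
      ∀ i ∈ S, ∀ j ∈ S, i ≠ j → Disjoint (C i) (C j) by
    obtain ⟨C, h1, h2⟩ := H T Subset.rfl
    exact ⟨C, fun i hi => (h1 i hi).1, h2⟩
  intro S
  induction S using Finset.induction_on with
  | empty => exact fun _ => ⟨fun _ => ∅, by simp, by simp⟩
  | insert a S ha ih =>
    intro hS
    obtain ⟨C, h1, h2⟩ := ih ((subset_insert _ _).trans hS)
    obtain ⟨D, hD1, hD2, hD3⟩ := h a (hS (mem_insert_self _ _)) (S.biUnion C) (by
      calc (S.biUnion C).card ≤ ∑ i ∈ S, (C i).card := card_biUnion_le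
        _ ≤ ∑ _i ∈ S, c := sum_le_sum fun i hi => (h1 i hi).2
        _ = c * S.card := by simp [mul_comm]
        _ ≤ _ := Nat.mul_le_mul_left _ (card_le_card ((subset_insert _ _).trans hS)))
    rw [disjoint_biUnion_right] at hD3
    have hne : ∀ i ∈ S, i ≠ a := fun i hi h => ha (h ▸ hi)
    refine ⟨Function.update C a D, ?_, ?_⟩
    · intro i hi
      rcases mem_insert.1 hi with rfl | hi
      · simp [hD1, hD2]
      · rw [Function.update_of_ne (hne i hi)]; exact h1 i hi
    · intro i hi j hj hij
      rcases mem_insert.1 hi with rfl | hi' <;> rcases mem_insert.1 hj with rfl | hj'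
      · exact (hij rfl).elim
      · rw [Function.update_self, Function.update_of_ne (hne j hj')]; exact hD3 j hj'
      · rw [Function.update_self, Function.update_of_ne (hne i hi')]; exact (hD3 i hi').symm
      · rw [Function.update_of_ne (hne i hi'), Function.update_of_ne (hne j hj')]
        exact h2 i hi' j hj' hij

/-! ### Cliques -/

variable {G : SimpleGraph α}

theorem SimpleGraph.IsNClique.exists_subset {a b : ℕ} {A : Finset α} (h : G.IsNClique b A)
    (hab : a ≤ b) : ∃ B ⊆ A, G.IsNClique a B := by
  obtain ⟨B, hB, hB'⟩ := exists_subset_card_eq (h.card_eq.symm ▸ hab)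
  exact ⟨B, hB, ⟨h.isClique.subset (by exact_mod_cast hB), hB'⟩⟩

theorem isNClique_union {a b : ℕ} {A B : Finset α} (hA : G.IsNClique a A) (hB : G.IsNClique b B)
    (h : ∀ x ∈ A, ∀ y ∈ B, G.Adj x y) : G.IsNClique (a + b) (A ∪ B) := by
  have hd : Disjoint A B := disjoint_left.2 fun x hx hx' => G.irrefl (h x hx x hx')
  refine ⟨?_, by rw [card_union_of_disjoint hd, hA.card_eq, hB.card_eq]⟩
  intro x hx y hy hxy
  simp only [coe_union, Set.mem_union, mem_coe] at hx hy
  rcases hx with hx | hx <;> rcases hy with hy | hy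
  · exact hA.isClique hx hy hxy
  · exact h x hx y hy
  · exact (h y hy x hx).symm
  · exact hB.isClique hx hy hxy

/-- Ramsey's theorem by following the majority colour at a vertex. The crude bound 2^(a+b) is enough
for thresholds that are powers of 2^k. -/
theorem exists_clique_or_compl_clique (G : SimpleGraph α) (a b : ℕ) (X : Finset α)
    (hX : 2 ^ (a + b) ≤ X.card) :
    (∃ A ⊆ X, G.IsNClique a A) ∨ ∃ B ⊆ X, Gᶜ.IsNClique b B := by
  induction' hn : a + b with n ih generalizing a b X
  · exact Or.inl ⟨∅, by simp, by simp; omega⟩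
  · rcases Nat.eq_zero_or_pos a with rfl | ha
    · exact Or.inl ⟨∅, by simp, by simp⟩
    rcases Nat.eq_zero_or_pos b with rfl | hb
    · exact Or.inr ⟨∅, by simp, by simp⟩
    rw [hn] at hX
    have hpos : 0 < X.card := lt_of_lt_of_le (by positivity) hX
    obtain ⟨v, hv⟩ := card_pos.1 hpos
    have h1 := card_erase_of_mem hv
    have h2 := card_filter_add_card_filter_not (s := X.erase v) (fun u => G.Adj v u)
    have h3 : 2 ^ (n + 1) = 2 ^ n + 2 ^ n := by ring
    by_cases h4 : 2 ^ n ≤ ((X.erase v).filter (fun u => G.Adj v u)).card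
    · rcases ih (a - 1) b _ (by rwa [show a - 1 + b = n by omega]) (by omega) with
        ⟨A, hA, hA'⟩ | ⟨B, hB, hB'⟩
      · refine Or.inl ⟨insert v A, ?_, ?_⟩
        · refine insert_subset hv (hA.trans ((filter_subset _ _).trans (erase_subset _ _)))
        · have := hA'.insert (a := v) (fun b hb => (mem_filter.1 (hA hb)).2)
          rwa [show a - 1 + 1 = a by omega] at this
      · exact Or.inr ⟨B, hB.trans ((filter_subset _ _).trans (erase_subset _ _)), hB'⟩
    · rcases ih a (b - 1) ((X.erase v).filter (fun u => ¬ G.Adj v u))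
        (by rw [show a + (b - 1) = n by omega]; omega) (by omega) with
        ⟨A, hA, hA'⟩ | ⟨B, hB, hB'⟩
      · exact Or.inl ⟨A, hA.trans ((filter_subset _ _).trans (erase_subset _ _)), hA'⟩
      · refine Or.inr ⟨insert v B, ?_, ?_⟩
        · refine insert_subset hv (hB.trans ((filter_subset _ _).trans (erase_subset _ _)))
        · have := hB'.insert (a := v) (fun b hb => by
            have := mem_filter.1 (hB hb)
            rw [SimpleGraph.compl_adj]
            exact ⟨(ne_of_mem_erase this.1).symm, this.2⟩)
          rwa [show b - 1 + 1 = b by omega] at this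

/-- `G` has no clique of size `a` inside `X`. -/
def NoClique (G : SimpleGraph α) (a : ℕ) (X : Finset α) : Prop := ∀ A ⊆ X, ¬ G.IsNClique a A

theorem NoClique.mono {a : ℕ} (h : NoClique G a Y) (hXY : X ⊆ Y) : NoClique G a X :=
  fun A hA => h A (hA.trans hXY)

theorem NoClique.exists_clique {m : ℕ} (h : NoClique Gᶜ m X) (a : ℕ) (hX : 2 ^ (a + m) ≤ X.card) :
    ∃ A ⊆ X, G.IsNClique a A :=
  (exists_clique_or_compl_clique G a m X hX).resolve_right fun ⟨B, hB, hB'⟩ => h B hB hB'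

theorem NoClique.exists_clique_disjoint {m : ℕ} (h : NoClique Gᶜ m X) (a : ℕ) (Y : Finset α)
    (hX : 2 ^ (a + m) + Y.card ≤ X.card) : ∃ A ⊆ X, G.IsNClique a A ∧ Disjoint A Y := by
  have h1 := le_card_sdiff Y X
  obtain ⟨A, hA, hA'⟩ := (h.mono (X := X \ Y) sdiff_subset).exists_clique a (by omega)
  exact ⟨A, hA.trans sdiff_subset, hA', disjoint_of_subset_left hA sdiff_disjoint⟩

theorem NoClique.pack {m : ℕ} (h : NoClique Gᶜ m X) {a : ℕ} (ha : 0 < a) {j : ℕ}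
    (hj : a * j + 2 ^ (a + m) ≤ X.card) : Pack (G.IsNClique a) j X := by
  obtain ⟨i, Y, hY, hY1, hY2, hY3⟩ := exists_pack_leftover (P := G.IsNClique a) a ha
    (fun Y hY => hY.card_eq) X
  refine (hY2.mono_set sdiff_subset).of_le ?_
  by_contra hlt
  obtain ⟨A, hA, hA'⟩ := (h.mono hY).exists_clique a (by
    have : a * i ≤ a * j := Nat.mul_le_mul_left _ (by omega)
    omega)
  exact hY1 A hA hA'

/-- A clique splits into cliques of size `a` and a remainder smaller than `a`. -/
theorem pack_clique {a b : ℕ} {A : Finset α} (hA : G.IsNClique b A) {j : ℕ}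
    (hj : a * j ≤ b) : Pack (G.IsNClique a) j A := by
  induction j generalizing b A with
  | zero => exact Pack.zero
  | succ j ih =>
    rw [mul_add, mul_one] at hj
    obtain ⟨B, hB, hB'⟩ := hA.exists_subset (a := a) (by omega)
    have h1 : G.IsNClique (b - a) (A \ B) := by
      refine ⟨hA.isClique.subset (by exact_mod_cast sdiff_subset), ?_⟩
      rw [card_sdiff_of_subset hB, hA.card_eq, hB'.card_eq]
    exact ((ih h1 (by omega)).union (Pack.one hB') sdiff_disjoint).mono_set
      (union_subset sdiff_subset hB)

/-- The neighbours of `v` in `X`. -/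
noncomputable def nbrs (G : SimpleGraph α) (X : Finset α) (v : α) : Finset α :=
  X.filter (fun u => G.Adj v u)

theorem mem_nbrs {v u : α} : u ∈ nbrs G X v ↔ u ∈ X ∧ G.Adj v u := by
  rw [nbrs, mem_filter]

theorem nbrs_subset {v : α} : nbrs G X v ⊆ X := filter_subset _ _

theorem nbrs_mono {v : α} (h : X ⊆ Y) : nbrs G X v ⊆ nbrs G Y v := filter_subset_filter _ h

theorem card_nbrs_add_card_nbrs_compl {v : α} (hv : v ∉ X) :
    (nbrs G X v).card + (nbrs Gᶜ X v).card = X.card := by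
  have h : nbrs Gᶜ X v = X.filter (fun u => ¬ G.Adj v u) := by
    ext u
    rw [mem_nbrs, mem_filter, SimpleGraph.compl_adj]
    exact ⟨fun h => ⟨h.1, h.2.2⟩, fun h => ⟨h.1, fun e => hv (e ▸ h.1), h.2⟩⟩
  rw [h, nbrs, card_filter_add_card_filter_not]

/-- Pigeonhole: many vertices with `b` neighbours in `A` share `b` neighbours. -/
theorem exists_common_neighbors (G : SimpleGraph α) (A Y : Finset α) (b t : ℕ) (ht : 0 < t)
    (h : ∀ y ∈ Y, b ≤ (nbrs G A y).card) (hY : 2 ^ A.card * t ≤ Y.card) :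
    ∃ A' ⊆ A, A'.card = b ∧ ∃ Y' ⊆ Y, t ≤ Y'.card ∧ ∀ a ∈ A', ∀ y ∈ Y', G.Adj a y := by
  choose! f hf hf' using fun y hy => exists_subset_card_eq (h y hy)
  obtain ⟨A', hA', hA''⟩ := exists_le_card_fiber_of_mul_le_card_of_maps_to
    (s := Y) (t := A.powerset) (f := f) (n := t)
    (fun y hy => mem_powerset.2 ((hf y hy).trans nbrs_subset)) ⟨∅, by simp⟩
    (by rwa [card_powerset])
  obtain ⟨y, hy⟩ := card_pos.1 (lt_of_lt_of_le ht hA'')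
  rw [mem_filter] at hy
  refine ⟨A', mem_powerset.1 hA', hy.2 ▸ hf' y hy.1, Y.filter (fun y => f y = A'), filter_subset _ _,
    hA'', ?_⟩
  intro a ha y hy
  rw [mem_filter] at hy
  rw [← hy.2] at ha
  exact (mem_nbrs.1 (hf y hy.1 ha)).2.symm

end

section
open Classical Finset

/-! ### Copies of parts of a graph -/

/-- The subgraph of `H` on the vertex set `S` embeds into `G` with all vertices in `Y`. -/
def HostsOn {V α : Type*} (H : SimpleGraph V) (G : SimpleGraph α) (S : Finset V) (Y : Finset α) :
    Prop :=
  ∃ f : V → α, Set.InjOn f S ∧ (∀ v ∈ S, f v ∈ Y) ∧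
    ∀ v ∈ S, ∀ w ∈ S, H.Adj v w → G.Adj (f v) (f w)

/-- `G` contains a copy of `H` with all vertices in `Y`. -/
def Hosts {V α : Type*} [Fintype V] (H : SimpleGraph V) (G : SimpleGraph α) (Y : Finset α) : Prop :=
  HostsOn H G univ Y

/-- `G` contains, within `Y`, a copy of `H` minus some independent set. -/
def HostsCore {V α : Type*} [Fintype V] (H : SimpleGraph V) (G : SimpleGraph α)
    (Y : Finset α) : Prop :=
  ∃ I : Finset V, H.IsIndepSet I ∧ HostsOn H G Iᶜ Y

/-- No edge of `H` leaves the nonempty vertex set `S`. -/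
def IsClosedPart {V : Type*} (H : SimpleGraph V) (S : Finset V) : Prop :=
  S.Nonempty ∧ ∀ v ∈ S, ∀ w ∉ S, ¬ H.Adj v w

variable {V α : Type*} [Fintype V] [DecidableEq α] {H : SimpleGraph V}
  {G : SimpleGraph α} {S : Finset V} {X Y Z : Finset α}

theorem HostsOn.mono (h : HostsOn H G S Y) (hYZ : Y ⊆ Z) : HostsOn H G S Z := by
  obtain ⟨f, h1, h2, h3⟩ := h
  exact ⟨f, h1, fun v hv => hYZ (h2 v hv), h3⟩

theorem HostsOn.card_le (h : HostsOn H G S Y) : S.card ≤ Y.card := by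
  obtain ⟨f, h1, h2, h3⟩ := h
  exact card_le_card_of_injOn f h2 h1

theorem HostsOn.exists_subset (h : HostsOn H G S Y) :
    ∃ Z ⊆ Y, Z.card = S.card ∧ HostsOn H G S Z := by
  obtain ⟨f, h1, h2, h3⟩ := h
  exact ⟨S.image f, image_subset_iff.2 h2, card_image_of_injOn h1, f, h1,
    fun v hv => mem_image_of_mem f hv, h3⟩

theorem exists_injOn_of_card_le [Nonempty α] (h : S.card ≤ Y.card) :
    ∃ f : V → α, Set.InjOn f S ∧ ∀ v ∈ S, f v ∈ Y := by
  obtain ⟨e⟩ : Nonempty (S ↪ Y) := Function.Embedding.nonempty_of_card_le (by simpa using h)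
  refine ⟨fun v => if h : v ∈ S then e ⟨v, h⟩ else Classical.arbitrary α, ?_, ?_⟩
  · intro v hv w hw hvw
    rw [mem_coe] at hv hw
    simp only [hv, hw, dif_pos] at hvw
    simpa using e.injective (Subtype.ext hvw)
  · intro v hv
    simp [hv]

theorem hostsOn_of_isNClique [Nonempty α] {a : ℕ} (hY : G.IsNClique a Y) (hS : S.card ≤ a) :
    HostsOn H G S Y := by
  obtain ⟨f, h1, h2⟩ := exists_injOn_of_card_le (S := S) (Y := Y) (by rwa [hY.card_eq])
  exact ⟨f, h1, h2, fun v hv w hw hvw =>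
    hY.isClique (h2 v hv) (h2 w hw) fun h => hvw.ne (h1 hv hw h)⟩

theorem hostsOn_of_isIndepSet [Nonempty α] (hS : H.IsIndepSet S) (hY : S.card ≤ Y.card) :
    HostsOn H G S Y := by
  obtain ⟨f, h1, h2⟩ := exists_injOn_of_card_le (S := S) (Y := Y) hY
  exact ⟨f, h1, h2, fun v hv w hw hvw => (hS hv hw hvw.ne hvw).elim⟩

theorem HostsOn.hosts_union (hY : HostsOn H G S Y) (hZ : HostsOn H G Sᶜ Z) (hd : Disjoint Y Z)
    (h : ∀ v ∈ S, ∀ w ∉ S, H.Adj v w → ∀ y ∈ Y, ∀ z ∈ Z, G.Adj y z) : Hosts H G (Y ∪ Z) := by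
  obtain ⟨f, f1, f2, f3⟩ := hY
  obtain ⟨g, g1, g2, g3⟩ := hZ
  simp only [mem_compl] at g2 g3
  refine ⟨fun v => if v ∈ S then f v else g v, ?_, ?_, ?_⟩
  · rintro v - w - hvw
    by_cases hv : v ∈ S <;> by_cases hw : w ∈ S <;> simp only [hv, hw, if_true, if_false] at hvw
    · exact f1 hv hw hvw
    · exact (disjoint_left.1 hd (f2 v hv) (hvw ▸ g2 w hw)).elim
    · exact (disjoint_left.1 hd (f2 w hw) (hvw ▸ g2 v hv)).elim
    · exact g1 (by simpa using hv) (by simpa using hw) hvw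
  · rintro v -
    by_cases hv : v ∈ S <;> simp only [hv, if_true, if_false, mem_union]
    · exact Or.inl (f2 v hv)
    · exact Or.inr (g2 v hv)
  · rintro v - w - hvw
    by_cases hv : v ∈ S <;> by_cases hw : w ∈ S <;> simp only [hv, hw, if_true, if_false]
    · exact f3 v hv w hw hvw
    · exact h v hv w hw hvw _ (f2 v hv) _ (g2 w hw)
    · exact (h w hw v hv hvw.symm _ (f2 w hw) _ (g2 v hv)).symm
    · exact g3 v hv w hw hvw

theorem Hosts.mono (h : Hosts H G Y) (hYZ : Y ⊆ Z) : Hosts H G Z := HostsOn.mono h hYZ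

theorem hosts_of_isNClique [Nonempty α] (hY : G.IsNClique (Fintype.card V) Y) : Hosts H G Y :=
  hostsOn_of_isNClique hY (by simp)

theorem IsClosedPart.hosts_union (hS : IsClosedPart H S) (hY : HostsOn H G S Y)
    (hZ : HostsOn H G Sᶜ Z) (hd : Disjoint Y Z) : Hosts H G (Y ∪ Z) :=
  hY.hosts_union hZ hd fun v hv w hw hvw => (hS.2 v hv w hw hvw).elim

theorem hosts_union_of_complete [Nonempty α] (hS : H.IsIndepSet S) (hY : S.card ≤ Y.card)
    (hZ : HostsOn H G Sᶜ Z) (h : ∀ y ∈ Y, ∀ z ∈ Z, G.Adj y z) : Hosts H G (Y ∪ Z) :=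
  (hostsOn_of_isIndepSet hS hY).hosts_union hZ
    (disjoint_left.2 fun x hx hx' => G.irrefl (h x hx x hx')) fun _ _ _ _ _ => h

/-- A maximum independent set of H goes into `Y`, whose inner edges are irrelevant; the other |H| −
α(H) vertices go into the clique `Z`. -/
theorem hosts_of_link [Nonempty α] (hY : H.indepNum ≤ Y.card)
    (hZ : G.IsNClique (Fintype.card V - H.indepNum) Z) (h : ∀ y ∈ Y, ∀ z ∈ Z, G.Adj y z) :
    Hosts H G (Y ∪ Z) := by
  obtain ⟨I, hI⟩ := H.exists_isNIndepSet_indepNum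
  exact hosts_union_of_complete hI.isIndepSet (hI.card_eq ▸ hY)
    (hostsOn_of_isNClique hZ (by rw [card_compl, hI.card_eq])) h

theorem hostsCore_of_isNClique [Nonempty α] (hY : G.IsNClique (Fintype.card V - H.indepNum) Y) :
    HostsCore H G Y := by
  obtain ⟨I, hI⟩ := H.exists_isNIndepSet_indepNum
  exact ⟨I, hI.isIndepSet, hostsOn_of_isNClique hY (by rw [card_compl, hI.card_eq])⟩

theorem HostsCore.le_card (h : HostsCore H G Y) : Fintype.card V - H.indepNum ≤ Y.card := by
  obtain ⟨I, hI, h⟩ := h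
  have h1 := h.card_le
  have h2 := hI.card_le_indepNum
  rw [card_compl] at h1
  omega

theorem indepNum_pos [Nonempty V] (H : SimpleGraph V) : 0 < H.indepNum := by
  obtain ⟨v⟩ := ‹Nonempty V›
  have := SimpleGraph.IsIndepSet.card_le_indepNum (G := H) (t := {v}) (by simp [SimpleGraph.IsIndepSet])
  exact lt_of_lt_of_le Nat.one_pos (by simpa using this)

theorem indepNum_lt_card [Nonempty V] (hH : ∀ v, ¬ H.IsIsolated v) :
    H.indepNum < Fintype.card V := by
  obtain ⟨I, hI⟩ := H.exists_isNIndepSet_indepNum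
  rw [← hI.card_eq]
  refine lt_of_le_of_ne (card_le_univ I) fun h => ?_
  obtain rfl := (card_eq_iff_eq_univ I).1 h
  obtain ⟨v⟩ := ‹Nonempty V›
  obtain ⟨w, hw⟩ := H.exists_adj_iff_not_isIsolated.2 (hH v)
  exact hI.isIndepSet (by simp) (by simp) hw.ne hw

/-- Between a set `A` of size `2 * b` and a large set `Y`, one of the two colours contains a
complete bipartite graph with `b` vertices in `A`. -/
theorem exists_link (G : SimpleGraph α) {b t : ℕ} (ht : 0 < t) {A Y : Finset α}
    (hA : A.card = 2 * b) (hd : Disjoint A Y) (hY : 2 * 2 ^ (2 * b) * t ≤ Y.card) :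
    ∃ A' ⊆ A, A'.card = b ∧ ∃ Y' ⊆ Y, t ≤ Y'.card ∧
      ((∀ a ∈ A', ∀ y ∈ Y', G.Adj a y) ∨ ∀ a ∈ A', ∀ y ∈ Y', Gᶜ.Adj a y) := by
  have h1 := card_filter_add_card_filter_not (s := Y) (fun y => b ≤ (nbrs G A y).card)
  by_cases h2 : 2 ^ A.card * t ≤ (Y.filter (fun y => b ≤ (nbrs G A y).card)).card
  · obtain ⟨A', hA', hb, Y', hY', ht, h⟩ := exists_common_neighbors G A _ b t ht
      (fun y hy => (mem_filter.1 hy).2) h2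
    exact ⟨A', hA', hb, Y', hY'.trans (filter_subset _ _), ht, Or.inl h⟩
  · obtain ⟨A', hA', hb, Y', hY', ht, h⟩ := exists_common_neighbors Gᶜ A
      (Y.filter (fun y => ¬ b ≤ (nbrs G A y).card)) b t ht (fun y hy => by
        rw [mem_filter] at hy
        have := card_nbrs_add_card_nbrs_compl (G := G) (disjoint_right.1 hd hy.1)
        omega) (by
      rw [hA] at h2 ⊢
      have : 2 * 2 ^ (2 * b) * t = 2 ^ (2 * b) * t + 2 ^ (2 * b) * t := by ring
      omega)
    exact ⟨A', hA', hb, Y', hY'.trans (filter_subset _ _), ht, Or.inr h⟩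

end

section
open Classical Finset

variable {α : Type*} [DecidableEq α] {G : SimpleGraph α}

/-! ### Dense subsets, chains of cliques and absorption -/

/-- If at least half of `X` has at most |X|/16 non-neighbours, that part is dense. Otherwise pass to
the non-neighbourhood of a bad vertex, at the cost of a factor 16: the forbidden clique size of Gᶜ
drops by one, so this happens at most m times. -/
theorem exists_dense_subset (G : SimpleGraph α) (m : ℕ) (X : Finset α) (h : NoClique Gᶜ m X) :
    ∃ B ⊆ X, X.card ≤ 16 ^ m * B.card ∧ ∀ v ∈ B, 8 * (nbrs Gᶜ B v).card ≤ B.card := by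
  induction m generalizing X with
  | zero => exact (h ∅ (by simp) (by simp)).elim
  | succ m ih =>
    have hs := card_filter_add_card_filter_not (s := X)
      (fun v => X.card < 16 * (nbrs Gᶜ X v).card)
    set N := X.filter (fun v => ¬ X.card < 16 * (nbrs Gᶜ X v).card) with hN
    have h16 : (1 : ℕ) ≤ 16 ^ m := Nat.one_le_pow _ _ (by norm_num)
    by_cases h1 : X.card ≤ 2 * N.card
    · refine ⟨N, filter_subset _ _, ?_, ?_⟩
      · calc X.card ≤ 2 * N.card := h1
          _ ≤ 16 ^ (m + 1) * N.card := Nat.mul_le_mul_right _ (by rw [pow_succ]; omega)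
      · intro v hv
        have h2 : (nbrs Gᶜ N v).card ≤ (nbrs Gᶜ X v).card :=
          card_le_card (nbrs_mono (filter_subset _ _))
        have h3 := (mem_filter.1 hv).2
        omega
    · have : 0 < (X.filter (fun v => X.card < 16 * (nbrs Gᶜ X v).card)).card := by omega
      obtain ⟨v, hv⟩ := card_pos.1 this
      rw [mem_filter] at hv
      obtain ⟨B, hB, hB1, hB2⟩ := ih (nbrs Gᶜ X v) (by
        intro A hA hc
        refine h (insert v A) (insert_subset hv.1 (hA.trans nbrs_subset)) ?_
        exact hc.insert fun b hb => (mem_nbrs.1 (hA hb)).2)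
      refine ⟨B, hB.trans nbrs_subset, ?_, hB2⟩
      calc X.card ≤ 16 * (nbrs Gᶜ X v).card := hv.2.le
        _ ≤ 16 * (16 ^ m * B.card) := Nat.mul_le_mul_left _ hB1
        _ = _ := by ring

theorem sum_card_nbrs_comm (A Y : Finset α) :
    ∑ a ∈ A, (nbrs G Y a).card = ∑ y ∈ Y, (nbrs G A y).card := by
  simp only [nbrs, card_filter]
  rw [sum_comm]
  simp only [G.adj_comm]

/-- Double counting of non-edges: each `a` has at most N/8 non-neighbours, so at most N/4 vertices
miss more than half of `A`. -/
theorem card_filter_nonadjacent_le {A Y : Finset α} {N : ℕ} (hA : A.Nonempty)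
    (h : ∀ a ∈ A, 8 * (nbrs Gᶜ Y a).card ≤ N) :
    4 * (Y.filter (fun y => A.card < 2 * (nbrs Gᶜ A y).card)).card ≤ N := by
  set W := Y.filter (fun y => A.card < 2 * (nbrs Gᶜ A y).card) with hW
  have h1 : W.card * A.card ≤ 2 * ∑ y ∈ Y, (nbrs Gᶜ A y).card := by
    calc W.card * A.card = ∑ _y ∈ W, A.card := by simp
      _ ≤ ∑ y ∈ W, 2 * (nbrs Gᶜ A y).card := sum_le_sum fun y hy => (mem_filter.1 hy).2.le
      _ = 2 * ∑ y ∈ W, (nbrs Gᶜ A y).card := by rw [mul_sum]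
      _ ≤ _ := Nat.mul_le_mul_left _ (sum_le_sum_of_subset (filter_subset _ _))
  rw [← sum_card_nbrs_comm] at h1
  have h2 : 8 * ∑ a ∈ A, (nbrs Gᶜ Y a).card ≤ A.card * N := by
    rw [mul_sum]
    calc _ ≤ ∑ _a ∈ A, N := sum_le_sum h
      _ = _ := by simp
  have h3 : A.card * (4 * W.card) ≤ A.card * N := by nlinarith
  exact Nat.le_of_mul_le_mul_left h3 hA.card_pos

/-- A sequence of `l` disjoint cliques in which consecutive cliques are completely joined. -/
structure IsCliqueChain (G : SimpleGraph α) (l : ℕ) (P : ℕ → Finset α) : Prop where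
  isClique : ∀ i < l, G.IsClique (P i : Set α)
  disjoint : ∀ i < l, ∀ j < l, i ≠ j → Disjoint (P i) (P j)
  adj : ∀ i, i + 1 < l → ∀ x ∈ P i, ∀ y ∈ P (i + 1), G.Adj x y

/-- The chain grows from a pending clique `A` of size 2b joined to its last block. Most vertices see
at least half of `A`, so by pigeonhole many share b neighbours `A'` there; `A'` becomes the next
block and a 2b-clique among those vertices becomes pending. -/
theorem exists_cliqueChain {m b : ℕ} (hb : 0 < b) {B : Finset α} (hB : NoClique Gᶜ m B)
    (hd : ∀ v ∈ B, 8 * (nbrs Gᶜ B v).card ≤ B.card) (l : ℕ) (h1 : 2 * 2 ^ (4 * b + m) ≤ B.card)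
    (h2 : 4 * (b * l + 2 * b) ≤ B.card) :
    ∃ P : ℕ → Finset α, ∃ A ⊆ B, IsCliqueChain G l P ∧ (∀ i < l, P i ⊆ B ∧ (P i).card = b) ∧
      G.IsNClique (2 * b) A ∧ (∀ i < l, Disjoint (P i) A) ∧
      ∀ i, i + 1 = l → ∀ x ∈ P i, ∀ y ∈ A, G.Adj x y := by
  induction l with
  | zero =>
    obtain ⟨A, hA, hA'⟩ := hB.exists_clique (2 * b) (by
      have : 2 ^ (2 * b + m) ≤ 2 ^ (4 * b + m) := Nat.pow_le_pow_right (by norm_num) (by omega)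
      omega)
    exact ⟨fun _ => ∅, A, hA, ⟨by simp, by simp, by simp⟩, by simp, hA', by simp, by simp⟩
  | succ l ih =>
    have h0 : b * (l + 1) = b * l + b := by ring
    rw [h0] at h2
    obtain ⟨P, A, hA, hP, hP', hAc, hAd, hAj⟩ := ih (by omega)
    set D := (range l).biUnion P ∪ A with hD
    have hDc : D.card ≤ b * l + 2 * b := by
      refine (card_union_le _ _).trans ?_
      rw [hAc.card_eq]
      refine Nat.add_le_add_right (card_biUnion_le.trans ?_) _
      rw [sum_congr rfl fun i hi => (hP' i (mem_range.1 hi)).2]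
      simp [mul_comm]
    have hAne : A.Nonempty := card_pos.1 (by rw [hAc.card_eq]; omega)
    have h3 := card_filter_nonadjacent_le (G := G) (Y := B) hAne fun a ha => hd a (hA ha)
    set W := B.filter (fun y => A.card < 2 * (nbrs Gᶜ A y).card) with hW
    have h4 := le_card_sdiff (D ∪ W) B
    have h5 := card_union_le D W
    have h6 : ∀ y ∈ B \ (D ∪ W), b ≤ (nbrs G A y).card := by
      intro y hy
      simp only [hW, hD, mem_sdiff, mem_union, mem_filter, not_or, not_and, not_lt] at hy
      have := card_nbrs_add_card_nbrs_compl (G := G) hy.2.1.2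
      have := hy.2.2 hy.1
      rw [hAc.card_eq] at *
      omega
    obtain ⟨A', hA', hA'b, Y, hY, hYc, hYj⟩ := exists_common_neighbors G A _ b (2 ^ (2 * b + m))
      (by positivity) h6 (by
        rw [hAc.card_eq, ← pow_add, show 2 * b + (2 * b + m) = 4 * b + m by ring]
        omega)
    have hYB : Y ⊆ B := hY.trans sdiff_subset
    obtain ⟨A₂, hA₂, hA₂c⟩ := (hB.mono hYB).exists_clique (2 * b) hYc
    have hYD : ∀ y ∈ Y, y ∉ D := fun y hy h => (mem_sdiff.1 (hY hy)).2 (mem_union_left _ h)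
    have hPD : ∀ i < l, P i ⊆ D := fun i hi x hx =>
      mem_union_left _ (mem_biUnion.2 ⟨i, mem_range.2 hi, hx⟩)
    have hne : ∀ i < l, i ≠ l := fun i hi => hi.ne
    have hup : ∀ i < l, Function.update P l A' i = P i := fun i hi =>
      Function.update_of_ne (hne i hi) _ _
    have hup' : Function.update P l A' l = A' := Function.update_self _ _ _
    have hcase : ∀ i < l + 1, i < l ∨ i = l := fun i hi => by omega
    refine ⟨Function.update P l A', A₂, hA₂.trans hYB, ⟨?_, ?_, ?_⟩, ?_, hA₂c, ?_, ?_⟩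
    · intro i hi
      rcases hcase i hi with hi | rfl
      · rw [hup i hi]; exact hP.isClique i hi
      · rw [hup']; exact hAc.isClique.subset (by exact_mod_cast hA')
    · intro i hi j hj hij
      rcases hcase i hi with hi | rfl <;> rcases hcase j hj with hj | rfl
      · rw [hup i hi, hup j hj]; exact hP.disjoint i hi j hj hij
      · rw [hup i hi, hup']; exact (hAd i hi).mono_right hA'
      · rw [hup j hj, hup']; exact ((hAd j hj).mono_right hA').symm
      · exact (hij rfl).elim
    · intro i hi
      rw [hup i (by omega)]
      rcases hcase _ hi with hi | hi
      · rw [hup _ hi]; exact hP.adj i hi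
      · rw [hi, hup']; exact fun x hx y hy => hAj i hi x hx y (hA' hy)
    · intro i hi
      rcases hcase i hi with hi | rfl
      · rw [hup i hi]; exact hP' i hi
      · rw [hup']; exact ⟨hA'.trans hA, hA'b⟩
    · intro i hi
      refine disjoint_right.2 fun y hy hy' => hYD y (hA₂ hy) ?_
      rcases hcase i hi with hi | rfl
      · rw [hup i hi] at hy'; exact hPD i hi hy'
      · rw [hup'] at hy'; exact mem_union_right _ (hA' hy')
    · intro i hi
      obtain rfl : i = l := by omega
      rw [hup']
      exact fun x hx y hy => hYj x hx y (hA₂ hy)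

/-- The fewer than `a` vertices left over in one block are completed to an a-clique by vertices of
the next block, so only the last block leaves a remainder. -/
theorem pack_cliqueChain {a : ℕ} (ha : 0 < a) {P : ℕ → Finset α} (l : ℕ)
    (hP : IsCliqueChain G (l + 1) P) (hPa : ∀ i < l + 1, a ≤ (P i).card) :
    ∃ j, ∃ R ⊆ P l, R.card < a ∧ Pack (G.IsNClique a) j ((range (l + 1)).biUnion P \ R) ∧
      a * j + R.card = ∑ i ∈ range (l + 1), (P i).card := by
  have split : ∀ Q : Finset α, G.IsClique (Q : Set α) → ∃ j, ∃ R ⊆ Q, R.card < a ∧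
      Pack (G.IsNClique a) j (Q \ R) ∧ Q.card = a * j + R.card := by
    intro Q hQ
    obtain ⟨j, R, hR, hR1, hR2, hR3⟩ := exists_pack_leftover (P := G.IsNClique a) a ha
      (fun Y hY => hY.card_eq) Q
    refine ⟨j, R, hR, ?_, hR2, hR3⟩
    by_contra hlt
    obtain ⟨Z, hZ, hZ'⟩ := exists_subset_card_eq (not_lt.1 hlt)
    exact hR1 Z hZ ⟨hQ.subset (by exact_mod_cast hZ.trans hR), hZ'⟩
  induction l with
  | zero =>
    obtain ⟨j, R, h1, h2, h3, h4⟩ := split (P 0) (hP.isClique 0 (by omega))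
    exact ⟨j, R, h1, h2, by simpa using h3, by simpa using h4.symm⟩
  | succ l ih =>
    obtain ⟨j, R, h1, h2, h3, h4⟩ := ih ⟨fun i hi => hP.isClique i (by omega),
      fun i hi j hj => hP.disjoint i (by omega) j (by omega), fun i hi => hP.adj i (by omega)⟩
      (fun i hi => hPa i (by omega))
    have hPl := hPa (l + 1) (by omega)
    obtain ⟨C, hC, hCc⟩ := exists_subset_card_eq (show a - R.card ≤ (P (l + 1)).card by omega)
    have hcl := hP.isClique (l + 1) (by omega)
    obtain ⟨j', R', h1', h2', h3', h4'⟩ := split (P (l + 1) \ C)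
      (hcl.subset (by exact_mod_cast sdiff_subset))
    have hRC : G.IsNClique a (R ∪ C) := by
      have := isNClique_union (G := G) (a := R.card) (b := a - R.card) (A := R) (B := C)
        ⟨(hP.isClique l (by omega)).subset (by exact_mod_cast h1), rfl⟩
        ⟨hcl.subset (by exact_mod_cast hC), hCc⟩
        (fun x hx y hy => hP.adj l (by omega) x (h1 hx) y (hC hy))
      rwa [show R.card + (a - R.card) = a by omega] at this
    have hdis : ∀ i < l + 1, Disjoint (P i) (P (l + 1)) := fun i hi =>
      hP.disjoint i (by omega) _ (by omega) (by omega)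
    have hdU : Disjoint ((range (l + 1)).biUnion P) (P (l + 1)) := by
      rw [disjoint_biUnion_left]
      exact fun i hi => hdis i (mem_range.1 hi)
    have hRU : R ⊆ (range (l + 1)).biUnion P :=
      h1.trans (subset_biUnion_of_mem P (mem_range.2 (by omega)))
    refine ⟨j + (1 + j'), R', h1'.trans sdiff_subset, h2', ?_, ?_⟩
    · refine (h3.union ((Pack.one hRC).union h3' ?_) ?_).mono_set ?_
      · rw [disjoint_left]
        intro x hx hx'
        simp only [mem_union, mem_sdiff] at hx hx'
        rcases hx with hx | hx
        · exact disjoint_left.1 hdU (hRU hx) hx'.1.1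
        · exact hx'.1.2 hx
      · rw [disjoint_left]
        intro x hx hx'
        simp only [mem_union, mem_sdiff] at hx hx'
        rcases hx' with (hx' | hx') | hx'
        · exact hx.2 hx'
        · exact disjoint_left.1 hdU hx.1 (hC hx')
        · exact disjoint_left.1 hdU hx.1 hx'.1.1
      · rw [range_add_one (n := l + 1), biUnion_insert]
        intro x hx
        have hR'P : x ∈ R' → x ∈ P (l + 1) ∧ x ∉ C := fun h => mem_sdiff.1 (h1' h)
        have hd' : x ∈ (range (l + 1)).biUnion P → x ∉ P (l + 1) := fun h => disjoint_left.1 hdU h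
        have hRx := @hRU x
        have hCx := @hC x
        simp only [mem_union, mem_sdiff] at hx ⊢
        tauto
    · have h5 := card_sdiff_of_subset hC
      rw [sum_range_succ, ← h4]
      have : a * (j + (1 + j')) = a * j + a + a * j' := by ring
      omega

end

/-! ### Absorption into a clique chain -/

section
open Classical Finset

variable {α : Type*} [DecidableEq α] {G : SimpleGraph α}

theorem IsCliqueChain.mono {l : ℕ} {P Q : ℕ → Finset α} (h : IsCliqueChain G l P)
    (hQ : ∀ i, Q i ⊆ P i) : IsCliqueChain G l Q :=
  ⟨fun i hi => (h.isClique i hi).subset (by exact_mod_cast hQ i),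
    fun i hi j hj hij => (h.disjoint i hi j hj hij).mono (hQ i) (hQ j),
    fun i hi x hx y hy => h.adj i hi x (hQ _ hx) y (hQ _ hy)⟩

/-- Distinct representatives can be chosen greedily, since each list is longer than the number of
choices to make. -/
theorem exists_injOn_choice {ι : Type*} [DecidableEq ι] [Nonempty ι] (Y : Finset α) (T : α → Finset ι)
    (h : ∀ y ∈ Y, Y.card < (T y).card) :
    ∃ g : α → ι, (∀ y ∈ Y, g y ∈ T y) ∧ Set.InjOn g Y := by
  obtain ⟨C, h1, h2⟩ := exists_disjoint_family Y (fun y C => ∃ i ∈ T y, C = {i}) 1 (by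
    intro y hy D hD
    obtain ⟨i, hi, hi'⟩ := exists_mem_notMem_of_card_lt_card (s := D) (t := T y)
      (lt_of_le_of_lt (by omega) (h y hy))
    exact ⟨{i}, ⟨i, hi, rfl⟩, by simp, by simpa using hi'⟩)
  choose! g hg hgC using h1
  refine ⟨g, hg, fun x hx y hy hxy => ?_⟩
  by_contra hne
  have := h2 x hx y hy hne
  rw [hgC x hx, hgC y hy, hxy] at this
  simp at this

/-- In a chain of blocks of size `2 * a`, every small set of vertices that have many
neighbours in many blocks can be packed together with the chain, up to a remainder smaller
than `a`. -/
theorem pack_absorb {a l : ℕ} (ha : 0 < a) {P : ℕ → Finset α} (hP : IsCliqueChain G (l + 1) P)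
    (hPc : ∀ i < l + 1, (P i).card = 2 * a) {Y : Finset α}
    (hYP : Disjoint Y ((range (l + 1)).biUnion P)) {T : α → Finset ℕ}
    (hYT : ∀ y ∈ Y, Y.card < (T y).card)
    (hT : ∀ y ∈ Y, ∀ i ∈ T y, i < l + 1 ∧ a ≤ (nbrs G (P i) y).card) {j : ℕ}
    (hj : a * j ≤ Y.card + 2 * a * (l + 1)) :
    Pack (G.IsNClique a) j (Y ∪ (range (l + 1)).biUnion P) := by
  obtain ⟨g, hg, hginj⟩ := exists_injOn_choice Y T hYT
  -- Each vertex `y` gets a block of its own and forms an a-clique with a − 1 of its neighbours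
  -- there.
  have hex : ∀ y ∈ Y, ∃ Z ⊆ nbrs G (P (g y)) y, Z.card = a - 1 := fun y hy =>
    exists_subset_card_eq (by have := (hT y hy _ (hg y hy)).2; omega)
  choose! Z hZ hZc using hex
  have hZP : ∀ y ∈ Y, Z y ⊆ P (g y) := fun y hy => (hZ y hy).trans nbrs_subset
  have hgl : ∀ y ∈ Y, g y < l + 1 := fun y hy => (hT y hy _ (hg y hy)).1
  set PP := (range (l + 1)).biUnion P with hPP
  set ZZ := Y.biUnion Z with hZZ
  have hPPi : ∀ i < l + 1, P i ⊆ PP := fun i hi => subset_biUnion_of_mem P (mem_range.2 hi)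
  have hZd : ∀ x ∈ Y, ∀ y ∈ Y, x ≠ y → Disjoint (Z x) (Z y) := fun x hx y hy hxy =>
    (hP.disjoint _ (hgl x hx) _ (hgl y hy) fun h => hxy (hginj hx hy h)).mono (hZP x hx) (hZP y hy)
  have hZZP : ZZ ⊆ PP := biUnion_subset.2 fun y hy => (hZP y hy).trans (hPPi _ (hgl y hy))
  have hZZc : ZZ.card = Y.card * (a - 1) := by
    rw [hZZ, card_biUnion hZd, sum_congr rfl hZc]; simp
  have hPPc : PP.card = 2 * a * (l + 1) := by
    rw [hPP, card_biUnion fun i hi j hj => hP.disjoint i (mem_range.1 hi) j (mem_range.1 hj),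
      sum_congr rfl fun i hi => hPc i (mem_range.1 hi)]
    simp [mul_comm]
  have hP'd := hP.mono (Q := fun i => P i \ ZZ) fun i => sdiff_subset
  -- As `g` is injective, a block loses at most a − 1 of its 2a vertices, so the rest is still a
  -- chain with blocks of size at least `a`.
  have hP'c : ∀ i < l + 1, a ≤ (P i \ ZZ).card := by
    intro i hi
    have h1 : (P i ∩ ZZ).card ≤ a - 1 := by
      by_cases h : ∃ y ∈ Y, g y = i
      · obtain ⟨y, hy, rfl⟩ := h
        rw [← hZc y hy]
        refine card_le_card fun x hx => ?_
        obtain ⟨hx1, hx2⟩ := mem_inter.1 hx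
        obtain ⟨y', hy', hxy'⟩ := mem_biUnion.1 hx2
        by_cases hyy : y' = y
        · exact hyy ▸ hxy'
        · exact (disjoint_left.1 (hP.disjoint _ (hgl y' hy') _ hi
            fun h => hyy (hginj hy' hy h)) (hZP y' hy' hxy') hx1).elim
      · have : P i ∩ ZZ = ∅ := by
          rw [eq_empty_iff_forall_notMem]
          intro x hx
          obtain ⟨hx1, hx2⟩ := mem_inter.1 hx
          obtain ⟨y', hy', hxy'⟩ := mem_biUnion.1 hx2
          exact disjoint_left.1 (hP.disjoint _ (hgl y' hy') _ hi fun h' => h ⟨y', hy', h'⟩)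
            (hZP y' hy' hxy') hx1
        simp [this]
    have h2 := card_sdiff_add_card_inter (P i) ZZ
    have h3 := hPc i hi
    omega
  obtain ⟨j', R, hR, hRa, hpack, hsum⟩ := pack_cliqueChain ha l hP'd hP'c
  have hU : (range (l + 1)).biUnion (fun i => P i \ ZZ) = PP \ ZZ := by
    ext x; simp only [hPP, mem_biUnion, mem_sdiff]; tauto
  rw [← card_biUnion fun i hi j hj => hP'd.disjoint i (mem_range.1 hi) j (mem_range.1 hj), hU,
    card_sdiff_of_subset hZZP, hPPc, hZZc] at hsum
  rw [hU] at hpack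
  have hY1 : Pack (G.IsNClique a) Y.card (Y ∪ ZZ) := by
    refine pack_of_family Y (fun y => insert y (Z y)) ?_ ?_
    · intro x hx y hy hxy
      have h1 : x ∉ Z y := fun h =>
        disjoint_left.1 hYP hx (hZZP (mem_biUnion.2 ⟨y, hy, h⟩))
      have h2 : y ∉ Z x := fun h =>
        disjoint_left.1 hYP hy (hZZP (mem_biUnion.2 ⟨x, hx, h⟩))
      simp only [disjoint_insert_left, disjoint_insert_right, mem_insert, not_or]
      exact ⟨⟨hxy.symm, h2⟩, h1, hZd x hx y hy hxy⟩
    · intro y hy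
      refine ⟨insert_subset (mem_union_left _ hy)
        ((subset_biUnion_of_mem Z hy).trans subset_union_right), ?_⟩
      have h1 : G.IsNClique (a - 1) (Z y) := ⟨(hP.isClique _ (hgl y hy)).subset
        (by exact_mod_cast hZP y hy), hZc y hy⟩
      have := h1.insert fun z hz => (mem_nbrs.1 (hZ y hy hz)).2
      rwa [show a - 1 + 1 = a by omega] at this
  refine ((hY1.union hpack ?_).mono_set ?_).of_le (m := j) ?_
  · rw [disjoint_left]
    intro x hx hx'
    simp only [mem_union, mem_sdiff] at hx hx'
    rcases hx with hx | hx
    · exact disjoint_left.1 hYP hx hx'.1.1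
    · exact hx'.1.2 hx
  · refine union_subset (union_subset_union_right hZZP) ?_
    exact (sdiff_subset.trans sdiff_subset).trans subset_union_right
  · by_contra hlt
    have h1 : a * (Y.card + j' + 1) ≤ a * j := Nat.mul_le_mul_left _ (by omega)
    have h2 : a * (Y.card + j' + 1) = Y.card * (a - 1) + Y.card + a * j' + a := by
      obtain ⟨c, rfl⟩ : ∃ c, a = c + 1 := ⟨a - 1, by omega⟩
      simp only [Nat.add_sub_cancel]; ring
    have h3 : Y.card * (a - 1) ≤ 2 * a * (l + 1) := by rw [← hZZc, ← hPPc]; exact card_le_card hZZP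
    omega

/-- A large set without large `Gᶜ`-cliques contains a large set `U` and a small set `P` such that
`U' ∪ P` has a perfect packing by cliques of size `a`, up to divisibility, for every `U' ⊆ U`. -/
theorem exists_absorber {a m : ℕ} (ha : 0 < a) {X : Finset α} (hX : NoClique Gᶜ m X)
    (hXc : 16 ^ m * (2 * 2 ^ (8 * a + m) + 16 * a * 2 ^ (a + m) + 16 * a) ≤ X.card) :
    ∃ U ⊆ X, ∃ P ⊆ X, Disjoint U P ∧ P.card = 4 * a * 2 ^ (a + m) ∧
      X.card ≤ 16 ^ m * (4 * U.card) ∧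
      ∀ U' ⊆ U, ∀ j, a * j ≤ U'.card + P.card → Pack (G.IsNClique a) j (U' ∪ P) := by
  obtain ⟨B, hBX, hBc, hBd⟩ := exists_dense_subset G m X hX
  have h16 : 0 < 16 ^ m := by positivity
  have hB := Nat.le_of_mul_le_mul_left (hXc.trans hBc) h16
  have hBn := hX.mono hBX
  set t := 2 ^ (a + m) with ht
  have htpos : 0 < t := by positivity
  -- There are 2t blocks: a vertex with fewer than t good blocks then has more than t bad ones, and
  -- a greedy leftover, having fewer than t vertices, can be matched into its good blocks.
  obtain ⟨l, hl⟩ : ∃ l, l + 1 = 2 * t := ⟨2 * t - 1, by omega⟩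
  have hbl : 2 * a * (l + 1) = 4 * a * t := by rw [hl]; ring
  have h16a : 16 * a * t = 4 * (4 * a * t) := by ring
  obtain ⟨P, -, -, hP, hPB, -⟩ := exists_cliqueChain (b := 2 * a) (by omega) hBn hBd (l + 1)
    (by rw [show 4 * (2 * a) + m = 8 * a + m by ring]; omega) (by rw [hbl]; omega)
  set PP := (range (l + 1)).biUnion P with hPP
  have hPPB : PP ⊆ B := biUnion_subset.2 fun i hi => (hPB i (mem_range.1 hi)).1
  have hPPc : PP.card = 4 * a * t := by
    rw [hPP, card_biUnion fun i hi j hj => hP.disjoint i (mem_range.1 hi) j (mem_range.1 hj),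
      sum_congr rfl fun i hi => (hPB i (mem_range.1 hi)).2, ← hbl]
    simp [mul_comm]
  set bad : ℕ → α → Prop := fun i u => (P i).card < 2 * (nbrs Gᶜ (P i) u).card with hbad
  set T : α → Finset ℕ := fun u => (range (l + 1)).filter (fun i => ¬ bad i u) with hT
  set U := (B \ PP).filter (fun u => t ≤ (T u).card) with hU
  set W := (B \ PP).filter (fun u => ¬ t ≤ (T u).card) with hW
  have hUW : U.card + W.card = (B \ PP).card := card_filter_add_card_filter_not _
  have hBP := card_sdiff_add_card_eq_card hPPB
  -- Counting bad pairs: at least t per vertex of `W`, at most |B|/4 per block over 2t blocks, so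
  -- |W| ≤ |B|/2.
  have hWc : 2 * W.card ≤ B.card := by
    have h1 : ∀ u ∈ W, t ≤ ((range (l + 1)).filter (fun i => bad i u)).card := by
      intro u hu
      have h1 := (mem_filter.1 hu).2
      have h2 := card_filter_add_card_filter_not (s := range (l + 1)) (fun i => bad i u)
      rw [card_range] at h2
      simp only [hT] at h1
      omega
    have h2 : ∑ u ∈ W, ((range (l + 1)).filter (fun i => bad i u)).card =
        ∑ i ∈ range (l + 1), (W.filter (fun u => bad i u)).card := by
      simp only [card_filter]; rw [sum_comm]
    have h3 : ∀ i ∈ range (l + 1), 4 * (W.filter (fun u => bad i u)).card ≤ B.card := by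
      intro i hi
      have hPi := hPB i (mem_range.1 hi)
      refine le_trans (Nat.mul_le_mul_left 4 (card_le_card (filter_subset_filter _ ?_)))
        (card_filter_nonadjacent_le (A := P i) (Y := B) (card_pos.1 (by omega))
          fun v hv => hBd v (hPi.1 hv))
      exact (filter_subset _ _).trans sdiff_subset
    have h4 : W.card * t ≤ ∑ u ∈ W, ((range (l + 1)).filter (fun i => bad i u)).card := by
      simpa using sum_le_sum h1
    have h5 : 4 * ∑ i ∈ range (l + 1), (W.filter (fun u => bad i u)).card ≤ 2 * t * B.card := by
      rw [mul_sum, ← hl]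
      simpa using sum_le_sum h3
    have h6 : t * (2 * W.card) ≤ t * B.card := by nlinarith
    exact Nat.le_of_mul_le_mul_left h6 htpos
  have hUB : U ⊆ B := (filter_subset _ _).trans sdiff_subset
  have hUP : Disjoint U PP := disjoint_of_subset_left (filter_subset _ _) sdiff_disjoint
  refine ⟨U, hUB.trans hBX, PP, hPPB.trans hBX, hUP, hPPc, ?_, ?_⟩
  · exact hBc.trans (Nat.mul_le_mul_left _ (by omega))
  · intro U' hU' j hj
    obtain ⟨i, Y, hY, hYn, hYp, hYc⟩ := exists_pack_leftover (P := G.IsNClique a) a ha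
      (fun Y hY => hY.card_eq) U'
    have hYt : Y.card < t := by
      by_contra h
      obtain ⟨A, hA, hA'⟩ := (hBn.mono (hY.trans (hU'.trans hUB))).exists_clique a (not_lt.1 h)
      exact hYn A hA hA'
    have hab := pack_absorb ha hP (fun i hi => (hPB i hi).2) (Y := Y) (T := T)
      (hUP.mono_left (hY.trans hU'))
      (fun y hy => lt_of_lt_of_le hYt (mem_filter.1 (hU' (hY hy))).2) (by
        intro y hy i hi
        simp only [hT, hbad, mem_filter, mem_range, not_lt] at hi
        refine ⟨hi.1, ?_⟩
        have h1 := card_nbrs_add_card_nbrs_compl (G := G) (X := P i) (v := y) (fun h =>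
          disjoint_left.1 hUP (hU' (hY hy)) (mem_biUnion.2 ⟨i, mem_range.2 hi.1, h⟩))
        have h2 := (hPB i hi.1).2
        omega) (j := j - i) (by
        rw [Nat.mul_sub, hbl, ← hPPc]; omega)
    refine ((hYp.union hab ?_).mono_set ?_).of_le (by omega)
    · rw [disjoint_union_right]
      exact ⟨sdiff_disjoint, hUP.mono_left (sdiff_subset.trans hU')⟩
    · exact union_subset (sdiff_subset.trans subset_union_left) (union_subset_union_left hY)

end

section
open Classical Finset

variable {V α : Type*} [Fintype V] [DecidableEq α] {H : SimpleGraph V} {G : SimpleGraph α}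

/-! ### Bowties -/

/-- A bowtie is a set of `2 |H| - α(H)` vertices containing copies of `H` in both colours. -/
def IsBowtie (H : SimpleGraph V) (G : SimpleGraph α) (S : Finset α) : Prop :=
  S.card = Fintype.card V + (Fintype.card V - H.indepNum) ∧ Hosts H G S ∧ Hosts H Gᶜ S

theorem IsBowtie.of_compl {S : Finset α} (h : IsBowtie H Gᶜ S) : IsBowtie H G S :=
  ⟨h.1, compl_compl G ▸ h.2.2, h.2.1⟩

theorem indepNum_le_card (H : SimpleGraph V) : H.indepNum ≤ Fintype.card V := by
  obtain ⟨I, hI⟩ := H.exists_isNIndepSet_indepNum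
  exact hI.card_eq ▸ card_le_univ I

theorem NoClique.of_compl_compl {m : ℕ} {X : Finset α} (h : NoClique G m X) :
    NoClique Gᶜᶜ m X := by rwa [compl_compl]

/-- One colour finds H in the clique `A`; the other places an independent set of H in `A` and the
remaining vertices in `Z'`. -/
theorem exists_bowtie_of_link [Nonempty α] {A Z : Finset α}
    (hA : G.IsNClique (Fintype.card V) A) (hZ : Gᶜ.IsNClique (Fintype.card V) Z)
    (h : ∀ a ∈ A, ∀ z ∈ Z, Gᶜ.Adj a z) :
    ∃ Z' ⊆ Z, IsBowtie H G (A ∪ Z') := by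
  have hi := indepNum_le_card H
  obtain ⟨Z', hZ', hZc⟩ := hZ.exists_subset (Nat.sub_le (Fintype.card V) H.indepNum)
  have hd : Disjoint A Z' := disjoint_left.2 fun x hx hx' => Gᶜ.irrefl (h x hx x (hZ' hx'))
  refine ⟨Z', hZ', ?_, (hosts_of_isNClique hA).mono subset_union_left,
    hosts_of_link (hA.card_eq ▸ hi) hZc fun a ha z hz => h a ha z (hZ' hz)⟩
  rw [card_union_of_disjoint hd, hA.card_eq, hZc.card_eq]

/-- By `exists_link`, half of `A` is joined in a single colour to many vertices of `Y`, among which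
there is a k-clique of Gᶜ. Whichever colour joins them, the two cliques contain a bowtie. -/
theorem exists_bowtie [Nonempty α] {A Y : Finset α} (hA : G.IsNClique (2 * Fintype.card V) A)
    (hd : Disjoint A Y) (hY : NoClique G (2 * Fintype.card V) Y)
    (hYc : 2 * 2 ^ (5 * Fintype.card V) ≤ Y.card) : ∃ S ⊆ A ∪ Y, IsBowtie H G S := by
  set k := Fintype.card V with hk
  obtain ⟨A', hA', hA'c, Y', hY', hY'c, h⟩ := exists_link G (b := k) (t := 2 ^ (k + 2 * k))
    (by positivity) hA.card_eq hd
    (by rw [mul_assoc, ← pow_add, show 2 * k + (k + 2 * k) = 5 * k by ring]; exact hYc)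
  obtain ⟨Z, hZ, hZc⟩ := (hY.mono hY').of_compl_compl.exists_clique k hY'c
  have hAc : G.IsNClique k A' := ⟨hA.isClique.subset (by exact_mod_cast hA'), hA'c⟩
  rcases h with h | h
  · obtain ⟨W, hW, hW'⟩ := exists_bowtie_of_link (H := H) (G := Gᶜ) hZc (compl_compl G ▸ hAc)
      fun z hz a ha => by rw [compl_compl]; exact (h a ha z (hZ hz)).symm
    exact ⟨Z ∪ W, union_subset ((hZ.trans hY').trans subset_union_right)
      ((hW.trans hA').trans subset_union_left), hW'.of_compl⟩
  · obtain ⟨W, hW, hW'⟩ := exists_bowtie_of_link (H := H) hAc hZc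
      fun a ha z hz => h a ha z (hZ hz)
    exact ⟨A' ∪ W, union_subset_union hA' ((hW.trans hZ).trans hY'), hW'⟩

/-- Remove 2k-cliques of G greedily. If there is none, Gᶜ-cliques pack almost everything. If there
is one, the remainder is small, since otherwise that clique and the remainder would give a bowtie,
so the removed cliques already pack almost everything. -/
theorem pack_of_no_bowtie [Nonempty α] [Nonempty V] {X : Finset α}
    (hX : ∀ S ⊆ X, ¬ IsBowtie H G S) :
    (∀ j, Fintype.card V * j + 2 * 2 ^ (5 * Fintype.card V) ≤ X.card → Pack (Hosts H G) j X) ∨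
    ∀ j, Fintype.card V * j + 2 * 2 ^ (5 * Fintype.card V) ≤ X.card → Pack (Hosts H Gᶜ) j X := by
  have hkpos : 0 < Fintype.card V := Fintype.card_pos
  set k := Fintype.card V with hk
  obtain ⟨i, Y, hY, hYn, hYp, hYc⟩ := exists_pack_leftover (P := G.IsNClique (2 * k)) (2 * k)
    (by omega) (fun Y hY => hY.card_eq) X
  rcases Nat.eq_zero_or_pos i with rfl | hi
  · right
    intro j hj
    have hYX : Y = X := eq_of_subset_of_card_le hY (by omega)
    rw [hYX] at hYn
    refine (NoClique.pack (G := Gᶜ) (m := 2 * k) (NoClique.of_compl_compl hYn) hkpos ?_).imp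
      fun Z _ hZ => ⟨Z, Subset.rfl, hosts_of_isNClique hZ⟩
    have : 2 ^ (k + 2 * k) ≤ 2 ^ (5 * k) := Nat.pow_le_pow_right (by norm_num) (by omega)
    omega
  · left
    intro j hj
    have hYlt : Y.card < 2 * 2 ^ (5 * k) := by
      by_contra hlt
      obtain ⟨F, -, hF⟩ := hYp
      obtain ⟨hF1, hF2⟩ := hF ⟨0, hi⟩
      obtain ⟨S, hS, hS'⟩ := exists_bowtie (H := H) hF2
        (disjoint_of_subset_left hF1 sdiff_disjoint) hYn (not_lt.1 hlt)
      exact hX S (hS.trans (union_subset (hF1.trans sdiff_subset) hY)) hS'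
    have h1 : Pack (Hosts H G) (i * 2) (X \ Y) := hYp.mul fun Z _ hZ =>
      (pack_clique hZ (a := k) (j := 2) (by omega)).imp
        fun W _ hW => ⟨W, Subset.rfl, hosts_of_isNClique hW⟩
    refine (h1.mono_set sdiff_subset).of_le ?_
    by_contra hlt
    have h2 : k * (i * 2) ≤ k * j := Nat.mul_le_mul_left _ (by omega)
    have h3 : k * (i * 2) = 2 * k * i := by ring
    omega

/-- Removing bowties outside a set `K` that contains many copies of `H` in both colours leaves
only few vertices outside `K`. -/
theorem exists_bowtie_free_remainder [Nonempty α] [Nonempty V] {X K : Finset α} {n j ω : ℕ}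
    (hK : K ⊆ X) (hr : ¬ Pack (Hosts H G) n X) (hb : ¬ Pack (Hosts H Gᶜ) n X)
    (hω : (Fintype.card V + (Fintype.card V - H.indepNum)) * n + ω ≤ X.card + 1)
    (hjr : Pack (Hosts H G) j K) (hjb : Pack (Hosts H Gᶜ) j K) :
    ∃ Y ⊆ X \ K, ∃ n', (Fintype.card V + (Fintype.card V - H.indepNum)) * n' + ω ≤
        K.card + Y.card + 1 ∧
      ¬ Pack (Hosts H G) n' (K ∪ Y) ∧ ¬ Pack (Hosts H Gᶜ) n' (K ∪ Y) ∧
      (Fintype.card V - H.indepNum) * Y.card +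
          (Fintype.card V + (Fintype.card V - H.indepNum)) * (Fintype.card V * j) ≤
        Fintype.card V * (K.card + 1) +
          (Fintype.card V + (Fintype.card V - H.indepNum)) * (2 * 2 ^ (5 * Fintype.card V)) := by
  have hkpos : 0 < Fintype.card V := Fintype.card_pos
  set k := Fintype.card V with hk
  set s := k - H.indepNum with hs
  set t := 2 * 2 ^ (5 * k) with ht
  induction n generalizing X with
  | zero => exact (hr Pack.zero).elim
  | succ n ih =>
    by_cases h : ∃ S ⊆ X \ K, IsBowtie H G S
    · obtain ⟨S, hS, hSb⟩ := h
      have hSX : S ⊆ X := hS.trans sdiff_subset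
      have hc := card_sdiff_add_card_eq_card hSX
      have hSc : S.card = k + s := hSb.1
      -- Deleting a bowtie lowers `n` by one in both colours and removes k + s vertices, which
      -- preserves the size hypothesis.
      obtain ⟨Y, hY, n', h1, h2⟩ := ih (X := X \ S)
        (fun x hx => mem_sdiff.2 ⟨hK hx, fun h => (mem_sdiff.1 (hS h)).2 hx⟩)
        (fun hp => hr ((hp.union (Pack.one hSb.2.1) sdiff_disjoint).mono_set
          (union_subset sdiff_subset hSX)))
        (fun hp => hb ((hp.union (Pack.one hSb.2.2) sdiff_disjoint).mono_set
          (union_subset sdiff_subset hSX)))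
        (by rw [mul_add, mul_one] at hω; omega)
      exact ⟨Y, hY.trans (sdiff_subset_sdiff sdiff_subset Subset.rfl), n', h1, h2⟩
    · push Not at h
      have hKX : K ∪ X \ K = X := union_sdiff_of_subset hK
      have hc := card_sdiff_add_card_eq_card hK
      refine ⟨X \ K, Subset.rfl, n + 1, by omega, by rwa [hKX], by rwa [hKX], ?_⟩
      -- No bowtie is left outside `K`, so one colour packs `i`, about (y − t)/k, copies there. With
      -- the `j` copies inside `K` this must stay below n + 1; eliminating `i` against the size
      -- hypothesis bounds `y`.
      set y := (X \ K).card with hy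
      obtain ⟨i, hi1, hi2⟩ : ∃ i, (i = 0 ∨ k * i + t ≤ y) ∧ y < k * (i + 1) + t := by
        refine ⟨(y - t) / k, ?_, ?_⟩
        · have := Nat.mul_div_le (y - t) k
          by_cases hyt : t ≤ y
          · right; omega
          · left; rw [show y - t = 0 by omega]; simp
        · have := Nat.lt_mul_div_succ (y - t) hkpos
          omega
      have key : j + i < n + 1 := by
        by_contra hle
        rcases pack_of_no_bowtie h with hp | hp
        · have : Pack (Hosts H G) i (X \ K) := by
            rcases hi1 with rfl | hi1
            · exact Pack.zero
            · exact hp i hi1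
          exact hr (((hjr.union this disjoint_sdiff).mono_set hKX.le).of_le (by omega))
        · have : Pack (Hosts H Gᶜ) i (X \ K) := by
            rcases hi1 with rfl | hi1
            · exact Pack.zero
            · exact hp i hi1
          exact hb (((hjb.union this disjoint_sdiff).mono_set hKX.le).of_le (by omega))
      have h1 : (k + s) * (j + i + 1) ≤ K.card + y + 1 := by
        have := Nat.mul_le_mul_left (k + s) (show j + i + 1 ≤ n + 1 by omega)
        omega
      have h2 : k * ((k + s) * (j + i + 1)) ≤ k * (K.card + y + 1) := Nat.mul_le_mul_left _ h1
      have h3 : (k + s) * y ≤ (k + s) * (k * (i + 1) + t) := Nat.mul_le_mul_left _ hi2.le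
      nlinarith

end

section
open Classical Finset

variable {V α β γ : Type*} [Fintype V] [DecidableEq α] [DecidableEq β] [DecidableEq γ]
  {H : SimpleGraph V}

/-! ### The auxiliary extremal function -/

/-- No closed part of `H` embeds into the colour `G` inside `X`. -/
def ClosedPartFree (H : SimpleGraph V) (G : SimpleGraph α) (X : Finset α) : Prop :=
  ∀ S, IsClosedPart H S → ¬ HostsOn H G S X

/-- `CoreAvoiding H n x`: some two-colouring on `x` vertices has no closed part of `H` in the first
colour and fewer than `n` disjoint copies of `H` minus an independent set in the second. -/
def CoreAvoiding (H : SimpleGraph V) (n x : ℕ) : Prop :=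
  ∃ G : SimpleGraph (Fin x), ClosedPartFree H G univ ∧ ¬ Pack (HostsCore H Gᶜ) n univ

theorem HostsOn.map {G : SimpleGraph α} {G' : SimpleGraph β} {φ : α → β} {S : Finset V}
    {Y : Finset α} (hφ : Function.Injective φ) (hG : ∀ a b, G.Adj a b → G'.Adj (φ a) (φ b))
    (h : HostsOn H G S Y) : HostsOn H G' S (Y.image φ) := by
  obtain ⟨f, h1, h2, h3⟩ := h
  exact ⟨φ ∘ f, hφ.comp_injOn h1, fun v hv => mem_image_of_mem _ (h2 v hv),
    fun v hv w hw hvw => hG _ _ (h3 v hv w hw hvw)⟩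

theorem Pack.map {P : Finset α → Prop} {Q : Finset β → Prop} {φ : α → β} {n : ℕ} {X : Finset α}
    (hφ : Function.Injective φ) (hPQ : ∀ Y, P Y → Q (Y.image φ)) (h : Pack P n X) :
    Pack Q n (X.image φ) := by
  obtain ⟨F, h1, h2⟩ := h
  exact ⟨fun i => (F i).image φ, fun i j hij => (disjoint_image hφ).2 (h1 hij),
    fun i => ⟨image_subset_image (h2 i).1, hPQ _ (h2 i).2⟩⟩

theorem coreAvoiding_card {G : SimpleGraph α} {X : Finset α} {n : ℕ} (h1 : ClosedPartFree H G X)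
    (h2 : ¬ Pack (HostsCore H Gᶜ) n X) : CoreAvoiding H n X.card := by
  set φ : Fin X.card → α := fun i => X.equivFin.symm i with hφ
  have hinj : Function.Injective φ := fun i j hij => X.equivFin.symm.injective (Subtype.ext hij)
  have hX : univ.image φ ⊆ X := by
    intro x hx
    obtain ⟨i, -, rfl⟩ := mem_image.1 hx
    exact (X.equivFin.symm i).2
  refine ⟨G.comap φ, fun S hS h => h1 S hS ((h.map hinj fun a b h => h).mono hX), fun h => h2 ?_⟩
  refine (h.map hinj ?_).mono_set hX
  rintro Y ⟨I, hI, hY⟩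
  refine ⟨I, hI, hY.map hinj fun a b h => ?_⟩
  rw [SimpleGraph.compl_adj] at h ⊢
  exact ⟨hinj.ne h.1, h.2⟩

/-- The whole vertex set of H is itself a closed part. -/
theorem ClosedPartFree.noClique [Nonempty V] [Nonempty α] {G : SimpleGraph α} {X : Finset α}
    (h : ClosedPartFree H G X) : NoClique G (Fintype.card V) X := fun _ hA hAc =>
  h univ ⟨univ_nonempty, by simp⟩ ((hosts_of_isNClique hAc).mono hA)

theorem CoreAvoiding.lt [Nonempty V] (hH : ∀ v, ¬ H.IsIsolated v) {n x : ℕ}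
    (h : CoreAvoiding H n x) :
    x < (Fintype.card V - H.indepNum) * n + 2 ^ (Fintype.card V - H.indepNum + Fintype.card V) := by
  obtain ⟨G, h1, h2⟩ := h
  by_contra hle
  have hs := indepNum_lt_card hH
  have : 0 < 2 ^ (Fintype.card V - H.indepNum + Fintype.card V) := by positivity
  have : Nonempty (Fin x) := ⟨⟨0, by omega⟩⟩
  refine h2 ((NoClique.pack (G := Gᶜ) h1.noClique.of_compl_compl (by omega) ?_).imp
    fun Y _ hY => ⟨Y, Subset.rfl, hostsCore_of_isNClique hY⟩)
  simpa using hle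

/-- The edgeless graph works: without isolated vertices every closed part of H has an edge, and each
core needs |H| − α(H) vertices. -/
theorem coreAvoiding_of_lt [Nonempty V] (hH : ∀ v, ¬ H.IsIsolated v) {n x : ℕ}
    (hx : x < (Fintype.card V - H.indepNum) * n) : CoreAvoiding H n x := by
  refine ⟨⊥, ?_, fun h => ?_⟩
  · rintro S ⟨⟨v, hv⟩, hS⟩ ⟨f, -, -, h3⟩
    obtain ⟨w, hw⟩ := H.exists_adj_iff_not_isIsolated.2 (hH v)
    exact h3 v hv w (by_contra fun hwS => hS v hv w hwS hw) hw
  · have := h.mul_le_card fun Y hY => hY.le_card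
    simp at this
    omega

/-- The largest `x` with `CoreAvoiding H n x`. -/
noncomputable def coreNumber (H : SimpleGraph V) (n : ℕ) : ℕ :=
  Nat.findGreatest (CoreAvoiding H n)
    ((Fintype.card V - H.indepNum) * n + 2 ^ (Fintype.card V - H.indepNum + Fintype.card V))

theorem coreAvoiding_coreNumber [Nonempty V] (hH : ∀ v, ¬ H.IsIsolated v) {n : ℕ} (hn : 0 < n) :
    CoreAvoiding H n (coreNumber H n) := by
  have := Nat.mul_pos (Nat.sub_pos_of_lt (indepNum_lt_card hH)) hn
  exact Nat.findGreatest_spec ((Nat.sub_le _ 1).trans (Nat.le_add_right _ _))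
    (coreAvoiding_of_lt hH (by omega))

theorem CoreAvoiding.le_coreNumber [Nonempty V] (hH : ∀ v, ¬ H.IsIsolated v) {n x : ℕ}
    (h : CoreAvoiding H n x) : x ≤ coreNumber H n :=
  Nat.le_findGreatest (h.lt hH).le h

/-- An s-clique of Gᶜ contains a core, so removing one costs s vertices and lowers the number of
cores still to be avoided by one. -/
theorem CoreAvoiding.of_succ [Nonempty V] (hH : ∀ v, ¬ H.IsIsolated v) {n x : ℕ}
    (hn : 2 ^ (Fintype.card V - H.indepNum + Fintype.card V) ≤ n)
    (h : CoreAvoiding H (n + 1) (x + (Fintype.card V - H.indepNum))) : CoreAvoiding H n x := by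
  have hs := Nat.sub_pos_of_lt (indepNum_lt_card hH)
  set s := Fintype.card V - H.indepNum with hs'
  by_cases hx : x < s * n
  · exact coreAvoiding_of_lt hH hx
  have hsn : n ≤ s * n := Nat.le_mul_of_pos_left _ hs
  obtain ⟨G, h1, h2⟩ := h
  have : Nonempty (Fin (x + s)) := ⟨⟨0, by omega⟩⟩
  obtain ⟨Z, -, hZ⟩ := (h1.noClique).of_compl_compl.exists_clique s (by simp; omega)
  have hc : (univ \ Z : Finset (Fin (x + s))).card = x := by
    rw [card_sdiff_of_subset (subset_univ _), hZ.card_eq]; simp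
  rw [← hc]
  refine coreAvoiding_card (fun S hS h => h1 S hS (h.mono (subset_univ _))) fun h => h2 ?_
  exact (h.union (Pack.one (hostsCore_of_isNClique hZ)) sdiff_disjoint).mono_set (subset_univ _)

/-- Coarsens the bounds of `exists_absorber` to powers of q = 2^k, so that later comparisons follow
from 4q^i ≤ q^(i+1) and k < q. -/
theorem exists_absorber_of_two_pow {k a q : ℕ} (hk : 2 ≤ k) (hq : q = 2 ^ k)
    (ha : 0 < a) (hak : a ≤ k) {G : SimpleGraph α} {X : Finset α} (hX : NoClique Gᶜ k X)
    (hXc : q ^ 14 ≤ X.card) :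
    ∃ U ⊆ X, ∃ P ⊆ X, Disjoint U P ∧ P.card ≤ q ^ 4 ∧ X.card ≤ q ^ 5 * U.card ∧
      ∀ U' ⊆ U, ∀ j, a * j ≤ U'.card + P.card → Pack (G.IsNClique a) j (U' ∪ P) := by
  have hq4 : 4 ≤ q := by
    rw [hq]; exact (Nat.pow_le_pow_right (by norm_num) hk : 2 ^ 2 ≤ 2 ^ k)
  have hkq : k < q := hq ▸ Nat.lt_two_pow_self
  have h16 : 16 ^ k = q ^ 4 := by rw [hq, ← pow_mul, mul_comm, pow_mul]; norm_num
  have hpow : ∀ b c, b ≤ k * c → 2 ^ b ≤ q ^ c := fun b c h => by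
    rw [hq, ← pow_mul]; exact Nat.pow_le_pow_right (by norm_num) h
  have h1 := hpow (8 * a + k) 9 (by omega)
  have h2 := hpow (a + k) 2 (by omega)
  have hstep : ∀ i, 4 * q ^ i ≤ q ^ (i + 1) := fun i => by
    rw [pow_succ, mul_comm]; exact Nat.mul_le_mul_left _ hq4
  have h3 : a * 2 ^ (a + k) ≤ q * q ^ 2 := Nat.mul_le_mul (by omega) h2
  have h4 : q * q ^ 2 = q ^ 3 := by ring
  have s1 := hstep 1; have s2 := hstep 2; have s3 := hstep 3; have s4 := hstep 4
  have s5 := hstep 5; have s6 := hstep 6; have s7 := hstep 7; have s8 := hstep 8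
  have s9 := hstep 9
  simp only [Nat.reduceAdd, pow_one] at s1 s2 s3 s4 s5 s6 s7 s8 s9
  obtain ⟨U, hU, P, hP, hUP, hPc, hUc, hex⟩ := exists_absorber ha hX (by
    refine le_trans ?_ hXc
    rw [h16, show q ^ 14 = q ^ 4 * q ^ 10 by ring]
    refine Nat.mul_le_mul_left _ ?_
    have : 16 * a * 2 ^ (a + k) = 16 * (a * 2 ^ (a + k)) := by ring
    omega)
  refine ⟨U, hU, P, hP, hUP, ?_, ?_, hex⟩
  · have : 4 * a * 2 ^ (a + k) = 4 * (a * 2 ^ (a + k)) := by ring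
    omega
  · refine hUc.trans ?_
    rw [h16, ← mul_assoc]
    refine Nat.mul_le_mul_right _ ?_
    omega

/-- Replacing the vertices of a copy that lie in the right summand. -/
theorem HostsOn.replace_right [Nonempty β] {G' : SimpleGraph (β ⊕ γ)} {G : SimpleGraph β}
    {S : Finset V} {Y : Finset (β ⊕ γ)} {C : Finset β} (h : HostsOn H G' S Y)
    (hC : Y.toRight.card ≤ C.card) (hd : Disjoint Y.toLeft C)
    (hll : ∀ a ∈ Y.toLeft, ∀ b ∈ Y.toLeft, G'.Adj (.inl a) (.inl b) → G.Adj a b)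
    (hlr : ∀ a ∈ Y.toLeft, ∀ b, G'.Adj (.inl a) (.inr b) → ∀ c ∈ C, G.Adj a c)
    (hrr : ∀ b b', G'.Adj (.inr b) (.inr b') → G.IsClique C) :
    HostsOn H G S (Y.toLeft ∪ C) := by
  obtain ⟨f, h1, h2, h3⟩ := h
  have hR : (S.filter (fun v => (f v).isRight)).card ≤ C.card := by
    refine le_trans ?_ hC
    rw [← card_map (s := Y.toRight) .inr]
    refine card_le_card_of_injOn f ?_ (h1.mono (by exact_mod_cast filter_subset _ _))
    intro v hv
    rw [mem_coe, mem_filter] at hv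
    have := h2 v hv.1
    cases hfv : f v with
    | inl a => simp [hfv] at hv
    | inr b => simpa [hfv] using this
  obtain ⟨g, g1, g2⟩ := exists_injOn_of_card_le hR
  have hgm : ∀ v ∈ S, ∀ b, f v = .inr b → v ∈ S.filter (fun v => (f v).isRight) :=
    fun v hv b hb => by simp [hv, hb]
  refine ⟨fun v => Sum.elim id (fun _ => g v) (f v), ?_, ?_, ?_⟩
  · intro v hv w hw hvw
    rw [mem_coe] at hv hw
    have hv2 := h2 v hv
    have hw2 := h2 w hw
    have hvg := hgm v hv
    have hwg := hgm w hw
    rcases hfv : f v with a | b <;> rcases hfw : f w with a' | b' <;>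
      simp only [hfv, hfw, Sum.elim_inl, Sum.elim_inr, id] at hvw hv2 hw2
    · exact h1 hv hw (by rw [hfv, hfw, hvw])
    · exact (disjoint_left.1 hd (mem_toLeft.2 hv2) (hvw ▸ g2 w (hwg b' hfw))).elim
    · exact (disjoint_left.1 hd (mem_toLeft.2 hw2) (hvw ▸ g2 v (hvg b hfv))).elim
    · exact g1 (hvg b hfv) (hwg b' hfw) hvw
  · intro v hv
    have hv2 := h2 v hv
    have hvg := hgm v hv
    rcases hfv : f v with a | b <;> simp only [hfv, Sum.elim_inl, Sum.elim_inr, id] at hv2 ⊢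
    · exact mem_union_left _ (mem_toLeft.2 hv2)
    · exact mem_union_right _ (g2 v (hvg b hfv))
  · intro v hv w hw hvw
    have hadj := h3 v hv w hw hvw
    have hv2 := h2 v hv
    have hw2 := h2 w hw
    have hvg := hgm v hv
    have hwg := hgm w hw
    rcases hfv : f v with a | b <;> rcases hfw : f w with a' | b' <;>
      simp only [hfv, hfw, Sum.elim_inl, Sum.elim_inr, id] at hadj hv2 hw2 ⊢
    · exact hll a (mem_toLeft.2 hv2) a' (mem_toLeft.2 hw2) hadj
    · exact hlr a (mem_toLeft.2 hv2) b' hadj _ (g2 w (hwg b' hfw))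
    · exact (hlr a' (mem_toLeft.2 hw2) b hadj.symm _ (g2 v (hvg b hfv))).symm
    · exact hrr b b' hadj (g2 v (hvg b hfv)) (g2 w (hwg b' hfw)) fun h =>
        hvw.ne (g1 (hvg b hfv) (hwg b' hfw) h)

end

/-! ### The recurrence for the core number -/

section
open Classical Finset

variable {V α β γ : Type*} [Fintype V] [DecidableEq α] [DecidableEq β] [DecidableEq γ]
  {H : SimpleGraph V}

/-- `G` together with the independent set `γ`, completely joined to each other. -/
def joinIndep (G : SimpleGraph β) (γ : Type*) : SimpleGraph (β ⊕ γ) :=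
  (G ⊕g ⊥) ⊔ completeBipartiteGraph β γ

/-- New vertices used by a closed part can be exchanged for vertices of `U` adjacent to all of `E`:
the new vertices span no edges, so nothing is required among the replacements. -/
theorem closedPartFree_joinIndep [Nonempty β] [Fintype γ] {G : SimpleGraph β} {X E U : Finset β}
    {c : ℕ} (hX : ClosedPartFree H G X) (hE : E ⊆ X) (hU : U ⊆ X) (hEU : Disjoint E U)
    (hc : ∀ e ∈ E, (nbrs Gᶜ U e).card ≤ c) (hUc : Fintype.card V + E.card * c ≤ U.card) :
    ClosedPartFree H (joinIndep G γ) (E.disjSum univ) := by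
  intro S hS h
  obtain ⟨Y, hY, hYc, h⟩ := h.exists_subset
  set C := U \ E.biUnion (nbrs Gᶜ U) with hC
  have h1 : (E.biUnion (nbrs Gᶜ U)).card ≤ E.card * c := card_biUnion_le_card_mul _ _ _ hc
  have h2 := le_card_sdiff (E.biUnion (nbrs Gᶜ U)) U
  rw [← hC] at h2
  have h3 := card_le_univ S
  have h4 : Y.toRight.card ≤ Y.card := by
    have := card_toLeft_add_card_toRight (u := Y); omega
  have hYE : Y.toLeft ⊆ E := fun e he => by simpa using hY (mem_toLeft.1 he)
  refine hX S hS ((h.replace_right (G := G) (C := C) (by omega)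
    (hEU.mono hYE sdiff_subset) ?_ ?_ ?_).mono
    (union_subset (hYE.trans hE) (sdiff_subset.trans hU)))
  · intro a _ b _ hab
    simpa [joinIndep] using hab
  · intro a ha b _ u hu
    rw [hC, mem_sdiff, mem_biUnion] at hu
    by_contra hau
    exact hu.2 ⟨a, hYE ha, mem_nbrs.2 ⟨hu.1, by
      rw [SimpleGraph.compl_adj]
      exact ⟨fun h => disjoint_left.1 hEU (hYE ha) (h ▸ hu.1), hau⟩⟩⟩
  · intro b b' h
    simp [joinIndep] at h

theorem HostsCore.replace_right [Nonempty β] {G : SimpleGraph β} {Y : Finset (β ⊕ γ)} {C : Finset β}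
    (h : HostsCore H (joinIndep G γ)ᶜ Y) (hC : Gᶜ.IsNClique Y.toRight.card C)
    (hd : Disjoint Y.toLeft C) : HostsCore H Gᶜ (Y.toLeft ∪ C) := by
  obtain ⟨I, hI, h⟩ := h
  refine ⟨I, hI, h.replace_right hC.card_eq.ge hd ?_ ?_ fun _ _ _ => hC.isClique⟩
  · intro a _ b _ hab
    rw [SimpleGraph.compl_adj] at hab ⊢
    simpa [joinIndep] using hab
  · intro a _ b hab
    simp [joinIndep] at hab

theorem HostsCore.exists_subset {G : SimpleGraph α} {Y : Finset α} (h : HostsCore H G Y) :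
    ∃ Z ⊆ Y, HostsCore H G Z ∧ Z.card ≤ Fintype.card V := by
  obtain ⟨I, hI, h⟩ := h
  obtain ⟨Z, hZ, hZc, h⟩ := h.exists_subset
  exact ⟨Z, hZ, ⟨I, hI, h⟩, hZc.trans_le (card_le_univ _)⟩

/-- Disjoint copies of the core in the join, most of which lie entirely in the independent set,
are transferred back to the original vertices. -/
theorem pack_of_pack_joinIndep [Nonempty V] [Nonempty β] [Fintype γ] {G : SimpleGraph β}
    {E Rich U P Q : Finset β} {s n τ d : ℕ} (hs : s = Fintype.card V - H.indepNum) (hs0 : 0 < s)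
    (hER : Disjoint E Rich) (hEU : Disjoint (E ∪ Rich) (U ∪ P)) (hUP : Disjoint U P)
    (hQ : Disjoint (E ∪ Rich ∪ (U ∪ P)) Q)
    (hU : NoClique G (Fintype.card V) U) (hUc : 2 ^ (2 * Fintype.card V) + d ≤ U.card)
    (hR : ∀ r ∈ Rich, 2 ^ (2 * Fintype.card V) + d ≤ (nbrs Gᶜ U r).card)
    (hd : Fintype.card V * (E.card + Rich.card) ≤ d)
    (hpack : Pack (Gᶜ.IsNClique s) τ Q)
    (habs : ∀ U' ⊆ U, ∀ j, s * j ≤ U'.card + P.card → Pack (Gᶜ.IsNClique s) j (U' ∪ P))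
    (hγ : Fintype.card γ = U.card + P.card + Rich.card + s * (τ + 1))
    (h : Pack (HostsCore H (joinIndep G γ)ᶜ) (n + 1) (E.disjSum univ)) :
    Pack (HostsCore H Gᶜ) n (E ∪ Rich ∪ (U ∪ P) ∪ Q) := by
  obtain ⟨F, hF, hF'⟩ := h.imp (Q := fun Y => HostsCore H (joinIndep G γ)ᶜ Y ∧
    Y.card ≤ Fintype.card V) fun Y _ hY => hY.exists_subset
  have hsk : s ≤ Fintype.card V := by omega
  have hFE : ∀ i, (F i).toLeft ⊆ E := fun i e he => by simpa using (hF' i).1 (mem_toLeft.1 he)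
  have hFl : ∀ i j, i ≠ j → Disjoint (F i).toLeft (F j).toLeft := fun i j hij =>
    disjoint_left.2 fun x hx hx' =>
      disjoint_left.1 (hF hij) (mem_toLeft.1 hx) (mem_toLeft.1 hx')
  have hFr : ∀ i j, i ≠ j → Disjoint (F i).toRight (F j).toRight := fun i j hij =>
    disjoint_left.2 fun x hx hx' =>
      disjoint_left.1 (hF hij) (mem_toRight.1 hx) (mem_toRight.1 hx')
  have hFc : ∀ i, (F i).toLeft.card + (F i).toRight.card = (F i).card := fun i =>
    card_toLeft_add_card_toRight
  set T := univ.filter (fun i => (F i).toLeft.Nonempty) with hT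
  set b := fun i => (F i).toRight.card with hb
  have hbk : ∀ i, b i ≤ Fintype.card V := fun i => by
    have := hFc i; have := (hF' i).2.2; simp only [hb]; omega
  have ht : T.card ≤ E.card := by
    have := (pack_of_family (P := Finset.Nonempty) (X := E) T (fun i => (F i).toLeft)
      (fun i _ j _ hij => hFl i j hij) fun i hi => ⟨hFE i, (mem_filter.1 hi).2⟩).mul_le_card
      (c := 1) fun Y hY => hY.card_pos
    omega
  -- A core disjoint from `E` lies in γ and uses at least s of its vertices. This bounds what the
  -- cores meeting `E`, indexed by `T`, can use.
  have hsum : ∑ i ∈ T, b i + s * (n + 1 - T.card) ≤ Fintype.card γ := by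
    have h1 : ∑ i, b i ≤ Fintype.card γ := by
      rw [← card_biUnion (fun i _ j _ hij => hFr i j hij)]
      exact card_le_univ _
    have h2 : s * (n + 1 - T.card) ≤ ∑ i ∈ Tᶜ, b i := by
      have : Tᶜ.card = n + 1 - T.card := by rw [card_compl, Fintype.card_fin]
      rw [← this, mul_comm, ← smul_eq_mul]
      refine card_nsmul_le_sum _ _ _ fun i hi => ?_
      have h0 : (F i).toLeft = ∅ := by simpa [hT, not_nonempty_iff_eq_empty] using hi
      have := hFc i
      have := (hF' i).2.1.le_card
      rw [h0, card_empty] at *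
      simp only [hb]; omega
    have := sum_add_sum_compl T b
    omega
  have hpw : ∀ c ≤ Fintype.card V, 2 ^ (c + Fintype.card V) ≤ 2 ^ (2 * Fintype.card V) :=
    fun c hc => Nat.pow_le_pow_right (by norm_num) (by omega)
  -- Cliques to be found in `U`: one replacing the γ-part of each core that meets `E`, and one of
  -- size s − 1 completing each rich vertex. No edge of the complement joins `E` to γ, so the former
  -- need no adjacency to `E`.
  set f : Fin (n + 1) ⊕ β → ℕ := Sum.elim b (fun _ => s - 1) with hf
  set X : Fin (n + 1) ⊕ β → Finset β := Sum.elim (fun _ => U) (nbrs Gᶜ U) with hXdef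
  have hfk : ∀ i, f i ≤ Fintype.card V := by
    rintro (i | r)
    · exact hbk i
    · simp only [hf, Sum.elim_inr]; omega
  have hXU : ∀ i, X i ⊆ U := by
    rintro (i | r)
    · exact Subset.rfl
    · exact nbrs_subset
  obtain ⟨C, hC, hCd⟩ := exists_disjoint_family (T.disjSum Rich)
    (fun i C => C ⊆ X i ∧ Gᶜ.IsNClique (f i) C) (Fintype.card V) (by
      intro i hi Y hY
      have h1 : 2 ^ (2 * Fintype.card V) + d ≤ (X i).card := by
        rcases i with i | r
        · exact hUc
        · exact hR r (by simpa using hi)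
      have h2 : Y.card ≤ d := hY.trans (le_trans (Nat.mul_le_mul_left _ (by
        rw [card_disjSum]; omega)) hd)
      have h3 := hpw _ (hfk i)
      obtain ⟨C, hC, hCc, hCY⟩ := (hU.mono (hXU i)).of_compl_compl.exists_clique_disjoint
        (f i) Y (by omega)
      exact ⟨C, ⟨hC, hCc⟩, hCc.card_eq.trans_le (hfk i), hCY⟩)
  have hCU : ∀ i ∈ T.disjSum Rich, C i ⊆ U := fun i hi => (hC i hi).1.trans (hXU i)
  set W := (T.disjSum Rich).biUnion C with hW
  have hWU : W ⊆ U := biUnion_subset.2 hCU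
  have hWc : W.card = ∑ i ∈ T, b i + Rich.card * (s - 1) := by
    rw [hW, card_biUnion (fun i hi j hj hij => hCd i hi j hj hij),
      sum_congr rfl (fun i hi => (hC i hi).2.card_eq), sum_disjSum]
    simp
  set L : Fin (n + 1) ⊕ β → Finset β := Sum.elim (fun i => (F i).toLeft) (fun r => {r}) with hL
  have hLE : ∀ i ∈ T.disjSum Rich, L i ⊆ E ∪ Rich := by
    rintro (i | r) hi
    · exact (hFE i).trans subset_union_left
    · have hr : r ∈ Rich := by simpa using hi
      simp [hL, hr]
  have hLC : ∀ i ∈ T.disjSum Rich, ∀ j ∈ T.disjSum Rich, Disjoint (L i) (C j) := fun i hi j hj =>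
    hEU.mono (hLE i hi) ((hCU j hj).trans subset_union_left)
  have hLL : ∀ i ∈ T.disjSum Rich, ∀ j ∈ T.disjSum Rich, i ≠ j → Disjoint (L i) (L j) := by
    rintro (i | r) hi (j | r') hj hij
    · exact hFl i j (by simpa using hij)
    · exact hER.mono (hFE i) (by simpa [hL] using hj)
    · exact (hER.mono (hFE j) (by simpa [hL] using hi)).symm
    · simpa [hL] using hij
  have p1 : Pack (HostsCore H Gᶜ) (T.card + Rich.card) (E ∪ Rich ∪ W) := by
    rw [← card_disjSum]
    refine pack_of_family _ (fun i => L i ∪ C i) (fun i hi j hj hij => ?_) fun i hi => ⟨?_, ?_⟩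
    · rw [disjoint_union_left, disjoint_union_right, disjoint_union_right]
      exact ⟨⟨hLL i hi j hj hij, hLC i hi j hj⟩, (hLC j hj i hi).symm, hCd i hi j hj hij⟩
    · exact union_subset_union (hLE i hi) (subset_biUnion_of_mem C hi)
    · rcases i with i | r
      · exact (hF' i).2.1.replace_right (hC _ hi).2 (hLC _ hi _ hi)
      · refine hostsCore_of_isNClique (H := H) ?_
        have h1 := (hC _ hi).2
        have h2 := (hC _ hi).1
        simp only [hf, hXdef, Sum.elim_inr] at h1 h2
        have := isNClique_union (G := Gᶜ) (SimpleGraph.isNClique_one.2 ⟨r, rfl⟩) h1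
          fun x hx y hy => by
            rw [mem_singleton.1 hx]
            exact (mem_nbrs.1 (h2 hy)).2
        rwa [← hs, show s = 1 + (s - 1) by omega]
  have hU'c : (U \ W).card + W.card = U.card := card_sdiff_add_card_eq_card hWU
  have hcl : ∀ Y, Gᶜ.IsNClique s Y → HostsCore H Gᶜ Y := fun Y hY =>
    hostsCore_of_isNClique (hs ▸ hY)
  -- The count is exact: the s extra vertices of γ pay for the one core lost in passing from n + 1
  -- to n.
  have p2 := (habs (U \ W) sdiff_subset (n - T.card - Rich.card - τ) (by
    rcases Nat.lt_or_ge (T.card + Rich.card + τ) n with hlt | hge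
    · obtain ⟨e, he⟩ := Nat.exists_eq_add_of_lt hlt
      obtain ⟨s', hs'⟩ := Nat.exists_eq_add_of_lt hs0
      rw [show n - T.card - Rich.card - τ = e + 1 by omega]
      rw [show n + 1 - T.card = Rich.card + τ + e + 2 by omega] at hsum
      rw [show s - 1 = s' by omega] at hWc
      rw [show s = s' + 1 by omega] at hsum hγ ⊢
      nlinarith
    · rw [show n - T.card - Rich.card - τ = 0 by omega]; simp)).imp
    fun Y _ hY => ⟨Y, Subset.rfl, hcl Y hY⟩
  have p3 := hpack.imp fun Y _ hY => ⟨Y, Subset.rfl, hcl Y hY⟩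
  have hWU' : Disjoint (E ∪ Rich ∪ W) (U \ W ∪ P) := by
    rw [disjoint_union_left, disjoint_union_right (s := W)]
    exact ⟨hEU.mono_right (union_subset_union sdiff_subset Subset.rfl), disjoint_sdiff,
      hUP.mono_left hWU⟩
  have hsub : E ∪ Rich ∪ W ∪ (U \ W ∪ P) ⊆ E ∪ Rich ∪ (U ∪ P) := by
    refine union_subset (union_subset_union Subset.rfl (hWU.trans subset_union_left))
      ((union_subset_union sdiff_subset Subset.rfl).trans subset_union_right)
  refine (((p1.union p2 hWU').union p3 (hQ.mono_left hsub)).of_le (by omega)).mono_set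
    (union_subset_union hsub Subset.rfl)

/-- Outside an absorber for s-cliques of Gᶜ, all but fewer than q^2 vertices split into such
cliques. The exceptional vertices with few Gᶜ-neighbours in `U` are kept as `E`; everything else
becomes an independent set of G, enlarged by s vertices and joined to `E`. -/
theorem CoreAvoiding.succ [Nonempty V] (hH : ∀ v, ¬ H.IsIsolated v) {n x : ℕ}
    (hn : (2 ^ Fintype.card V) ^ 14 ≤ n) (h : CoreAvoiding H n x) :
    CoreAvoiding H (n + 1) (x + (Fintype.card V - H.indepNum)) := by
  have hi0 := indepNum_pos H
  have hi1 := indepNum_lt_card hH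
  set k := Fintype.card V with hk
  set s := k - H.indepNum with hs
  have hs0 : 0 < s := by omega
  by_cases hx : x < s * n
  · exact coreAvoiding_of_lt hH (by rw [mul_add, mul_one]; exact Nat.add_lt_add_right hx s)
  set q := 2 ^ k with hq
  have hq4 : 4 ≤ q := (Nat.pow_le_pow_right (by norm_num) (by omega) : 2 ^ 2 ≤ 2 ^ k)
  have hkq : k < q := Nat.lt_two_pow_self
  have hxn : q ^ 14 ≤ x := hn.trans ((Nat.le_mul_of_pos_left _ hs0).trans (not_lt.1 hx))
  have hq14 : 0 < q ^ 14 := by positivity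
  obtain ⟨G, h1, h2⟩ := h
  have : Nonempty (Fin x) := ⟨⟨0, by omega⟩⟩
  obtain ⟨U, -, P, -, hUP, hPc, hUc, habs⟩ := exists_absorber_of_two_pow (G := Gᶜ) (k := k)
    (a := s) (by omega) hq hs0 (by omega) h1.noClique.of_compl_compl (by simpa using hxn)
  obtain ⟨τ, E1, hE1, hE1c, hpack, hcard⟩ := exists_pack_leftover s hs0
    (P := Gᶜ.IsNClique s) (fun Y hY => hY.card_eq) (univ \ (U ∪ P))
  have hE1q : E1.card < q ^ 2 := by
    by_contra hle
    have hq2 : 2 ^ (s + k) ≤ q ^ 2 := by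
      rw [hq, ← pow_mul]; exact Nat.pow_le_pow_right (by norm_num) (by omega)
    obtain ⟨A, hA, hA'⟩ := NoClique.exists_clique (G := Gᶜ) (NoClique.mono h1.noClique
      (subset_univ E1)).of_compl_compl s
      (hq2.trans (not_lt.1 hle))
    exact hE1c A hA hA'
  set E := E1.filter (fun e => (nbrs Gᶜ U e).card ≤ q ^ 4) with hE
  set Rich := E1.filter (fun e => ¬ (nbrs Gᶜ U e).card ≤ q ^ 4) with hRich
  have hER : E ∪ Rich = E1 := filter_union_filter_not_eq _ _
  have hERd : Disjoint E Rich := disjoint_filter_filter_not _ _ _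
  have hERc : E.card + Rich.card = E1.card := card_filter_add_card_filter_not _
  have hEd : Disjoint E1 (U ∪ P) := disjoint_sdiff_self_left.mono_left hE1
  have hstep : ∀ i, 4 * q ^ i ≤ q ^ (i + 1) := fun i => by
    rw [pow_succ, mul_comm]; exact Nat.mul_le_mul_left _ hq4
  have s1 := hstep 1; have s2 := hstep 2; have s3 := hstep 3; have s4 := hstep 4
  have s5 := hstep 5; have s6 := hstep 6; have s7 := hstep 7; have s8 := hstep 8
  simp only [Nat.reduceAdd, pow_one] at s1 s2 s3 s4 s5 s6 s7 s8
  have hU9 : q ^ 9 ≤ U.card := by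
    have : q ^ 5 * q ^ 9 ≤ q ^ 5 * U.card := by
      rw [← pow_add]; exact hxn.trans (by simpa using hUc)
    exact Nat.le_of_mul_le_mul_left this (by positivity)
  have hUPc : (U ∪ P).card = U.card + P.card := card_union_of_disjoint hUP
  have hOc : (univ \ (U ∪ P)).card + (U ∪ P).card = x := by
    rw [card_sdiff_add_card_eq_card (subset_univ _)]; simp
  set M := U.card + P.card + Rich.card + s * (τ + 1) with hM
  have hXM : (E.disjSum (univ : Finset (Fin M))).card = x + s := by
    rw [card_disjSum, card_univ, Fintype.card_fin, hM, mul_add]; omega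
  rw [← hXM]
  refine coreAvoiding_card (G := joinIndep G (Fin M)) ?_ fun h => h2 ?_
  · refine closedPartFree_joinIndep (c := q ^ 4) h1 (subset_univ _) (subset_univ U)
      (hEd.mono (filter_subset _ _) subset_union_left) (fun e he => (mem_filter.1 he).2) ?_
    have : E.card * q ^ 4 ≤ q ^ 2 * q ^ 4 := Nat.mul_le_mul_right _ (by omega)
    rw [← pow_add] at this
    simp only [Nat.reduceAdd] at this
    omega
  · have h22 : 2 ^ (2 * k) = q ^ 2 := by rw [hq, ← pow_mul, mul_comm]
    have h33 : k * E1.card ≤ q * q ^ 2 := Nat.mul_le_mul hkq.le hE1q.le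
    have h34 : q * q ^ 2 = q ^ 3 := by ring
    refine (pack_of_pack_joinIndep (H := H) (Q := (univ \ (U ∪ P)) \ E1) (d := q ^ 3) (E := E)
      (Rich := Rich) hs hs0 hERd
      (by rwa [hER]) hUP ?_ (h1.noClique.mono (subset_univ _)) ?_ ?_ ?_ hpack habs ?_ h).mono_set
      (subset_univ _)
    · rw [hER, disjoint_union_left]
      exact ⟨disjoint_sdiff, disjoint_sdiff.mono_right sdiff_subset⟩
    · rw [h22]; omega
    · intro r hr
      have := (mem_filter.1 hr).2
      rw [h22]; omega
    · rw [hERc]; exact h33.trans h34.le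
    · simp [hM]

theorem coreNumber_succ [Nonempty V] (hH : ∀ v, ¬ H.IsIsolated v) {n : ℕ}
    (hn : (2 ^ Fintype.card V) ^ 14 ≤ n) :
    coreNumber H (n + 1) = coreNumber H n + (Fintype.card V - H.indepNum) := by
  have h0 : 0 < (2 ^ Fintype.card V) ^ 14 := by positivity
  have hs := Nat.sub_pos_of_lt (indepNum_lt_card hH)
  have hn1 := Nat.mul_le_mul_right (n + 1) hs
  have h1 := ((coreAvoiding_coreNumber hH (by omega)).succ hH hn).le_coreNumber hH
  have h2 := coreAvoiding_coreNumber hH (Nat.succ_pos n)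
  rw [← Nat.sub_add_cancel ((Nat.le_add_left _ _).trans h1)] at h2
  have h3 := (h2.of_succ hH (le_trans ?_ hn)).le_coreNumber hH
  · omega
  · rw [← pow_mul]
    exact Nat.pow_le_pow_right (by norm_num) (by omega)

end

/-! ### Links and completable sets -/

section
open Classical Finset

variable {V α : Type*} [Fintype V] [DecidableEq α] {H : SimpleGraph V} {G : SimpleGraph α}

/-- Either disjoint `P`-sets cover at least `d` points, or fewer than `d` points meet them all. -/
theorem exists_cover_or_exists_free {P : Finset α → Prop} (hP : ∀ Y, P Y → 0 < Y.card) (d : ℕ)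
    (X : Finset α) :
    (∃ m ≤ d, ∃ F : Fin m → Finset α, Pairwise (fun i j => Disjoint (F i) (F j)) ∧
      (∀ i, F i ⊆ X ∧ P (F i)) ∧ d ≤ ∑ i, (F i).card) ∨
    ∃ Y ⊆ X, X.card < Y.card + d ∧ ∀ Z ⊆ Y, ¬ P Z := by
  induction' d using Nat.strong_induction_on with d ih generalizing X
  rcases Nat.eq_zero_or_pos d with rfl | hd0
  · exact Or.inl ⟨0, le_rfl, fun _ => ∅, fun i => i.elim0, fun i => i.elim0, Nat.zero_le _⟩
  by_cases h : ∃ Z ⊆ X, P Z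
  · obtain ⟨Z, hZ, hPZ⟩ := h
    have hZ0 := hP Z hPZ
    have hc := card_sdiff_add_card_eq_card hZ
    rcases ih (d - Z.card) (by omega) (X \ Z) with ⟨m, hm, F, h1, h2, h3⟩ | ⟨Y, hY, h1, h2⟩
    · left
      refine ⟨m + 1, by omega, Fin.cons Z F, ?_, ?_, ?_⟩
      · intro i j hij
        have hZF : ∀ i, Disjoint Z (F i) := fun i => disjoint_sdiff.mono_right (h2 i).1
        induction i using Fin.cases with
        | zero =>
          induction j using Fin.cases with
          | zero => exact (hij rfl).elim
          | succ j => simpa using hZF j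
        | succ i =>
          induction j using Fin.cases with
          | zero => simpa using (hZF i).symm
          | succ j => simpa using h1 (fun h => hij (congrArg Fin.succ h))
      · intro i
        induction i using Fin.cases with
        | zero => exact ⟨hZ, hPZ⟩
        | succ i => simpa using ⟨(h2 i).1.trans sdiff_subset, (h2 i).2⟩
      · rw [Fin.sum_univ_succ]
        simp only [Fin.cons_zero, Fin.cons_succ]
        omega
    · have := card_le_card hY
      exact Or.inr ⟨Y, hY.trans sdiff_subset, by omega, h2⟩
  · exact Or.inr ⟨X, Subset.rfl, by omega, fun Z hZ hPZ => h ⟨Z, hZ, hPZ⟩⟩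

theorem pack_of_two_sides {P : Finset α → Prop} {a s c d : ℕ} {U B : Finset α}
    (h : ∀ U' ⊆ U, ∀ B' ⊆ B, c ≤ U'.card → d ≤ B'.card →
      ∃ A ⊆ U', ∃ Z ⊆ B', A.card = a ∧ Z.card = s ∧ P (A ∪ Z)) (hUB : Disjoint U B) {j : ℕ}
    (hU : a * j + c ≤ U.card + a) (hB : s * j + d ≤ B.card + s) : Pack P j (U ∪ B) := by
  induction j generalizing U B with
  | zero => exact Pack.zero
  | succ j ih =>
    rw [mul_add, mul_one] at hU hB
    obtain ⟨A, hA, Z, hZ, hAc, hZc, hP⟩ := h U Subset.rfl B Subset.rfl (by omega) (by omega)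
    have h1 := card_sdiff_add_card_eq_card hA
    have h2 := card_sdiff_add_card_eq_card hZ
    refine ((ih (U := U \ A) (B := B \ Z) (fun U' hU' B' hB' => h U' (hU'.trans sdiff_subset) B'
      (hB'.trans sdiff_subset)) (hUB.mono sdiff_subset sdiff_subset) (by omega) (by omega)).union
      (Pack.one hP) ?_).mono_set (union_subset (union_subset_union sdiff_subset sdiff_subset)
        (union_subset_union hA hZ))
    rw [disjoint_union_left, disjoint_union_right, disjoint_union_right]
    exact ⟨⟨sdiff_disjoint, hUB.mono sdiff_subset hZ⟩, (hUB.mono hA sdiff_subset).symm,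
      sdiff_disjoint⟩

/-- A clique in `R`, completely joined to a set in `B`, containing a copy of `H`. -/
def IsLink (H : SimpleGraph V) (G : SimpleGraph α) (R B Y : Finset α) : Prop :=
  ∃ A ⊆ R, ∃ Z ⊆ B, G.IsNClique (Fintype.card V - H.indepNum) A ∧ Z.card = H.indepNum ∧
    (∀ a ∈ A, ∀ z ∈ Z, G.Adj a z) ∧ Y = A ∪ Z

theorem IsLink.mono {R B R' B' Y : Finset α} (h : IsLink H G R B Y) (hR : R ⊆ R') (hB : B ⊆ B') :
    IsLink H G R' B' Y := by
  obtain ⟨A, hA, Z, hZ, h⟩ := h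
  exact ⟨A, hA.trans hR, Z, hZ.trans hB, h⟩

theorem IsLink.subset {R B Y : Finset α} (h : IsLink H G R B Y) : Y ⊆ R ∪ B := by
  obtain ⟨A, hA, Z, hZ, -, -, -, rfl⟩ := h
  exact union_subset_union hA hZ

theorem IsLink.card_eq {R B Y : Finset α} (h : IsLink H G R B Y) : Y.card = Fintype.card V := by
  obtain ⟨A, hA, Z, hZ, h1, h2, h3, rfl⟩ := h
  have := indepNum_le_card H
  rw [card_union_of_disjoint (disjoint_left.2 fun x hx hx' => G.irrefl (h3 x hx x hx')),
    h1.card_eq, h2]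
  omega

/-- A 2k-clique of G in `U` is half joined in one colour to many vertices of `B'`. In G this would
be a link; in Gᶜ it gives a copy with α(H) vertices in `U` and a clique of size |H| − α(H) in `B'`.
-/
theorem exists_hosts_of_no_link [Nonempty α] {R B U B' : Finset α} (hU : U ⊆ R) (hB : B' ⊆ B)
    (hd : Disjoint R B) (hR : NoClique Gᶜ (Fintype.card V) R)
    (hBc : NoClique G (Fintype.card V) B) (hl : ∀ Y, ¬ IsLink H G R B Y)
    (h1 : (2 ^ Fintype.card V) ^ 3 ≤ U.card) (h2 : 2 * (2 ^ Fintype.card V) ^ 4 ≤ B'.card) :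
    ∃ A ⊆ U, ∃ Z ⊆ B', A.card = H.indepNum ∧ Z.card = Fintype.card V - H.indepNum ∧
      Hosts H Gᶜ (A ∪ Z) := by
  have hi := indepNum_le_card H
  set k := Fintype.card V with hk
  obtain ⟨A, hA, hAc⟩ := (hR.mono hU).exists_clique (2 * k)
    (by rw [← pow_mul] at h1; convert h1 using 2; ring)
  obtain ⟨A', hA', hA'c, Y', hY', hY'c, h⟩ := exists_link (b := k) (t := 2 ^ (k + k)) G (by positivity)
    hAc.card_eq (hd.mono (hA.trans hU) hB) (by
      refine le_trans (le_of_eq ?_) h2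
      rw [← pow_mul, mul_assoc, ← pow_add]; congr 2; ring)
  have hcl : G.IsNClique k A' := ⟨hAc.isClique.subset (by exact_mod_cast hA'), hA'c⟩
  rcases h with h | h
  · obtain ⟨A₁, hA₁, hA₁c⟩ := hcl.exists_subset (Nat.sub_le k H.indepNum)
    obtain ⟨Z, hZ, hZc⟩ := exists_subset_card_eq (s := Y') (n := H.indepNum)
      ((Nat.le_of_lt (lt_of_le_of_lt (by omega) Nat.lt_two_pow_self)).trans hY'c)
    exact (hl _ ⟨A₁, hA₁.trans (hA'.trans (hA.trans hU)), Z, hZ.trans (hY'.trans hB), hA₁c, hZc,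
      fun a ha z hz => h a (hA₁ ha) z (hZ hz), rfl⟩).elim
  · obtain ⟨Z₀, hZ₀, hZ₀c⟩ := NoClique.exists_clique (G := Gᶜ)
      (hBc.mono (hY'.trans hB)).of_compl_compl k hY'c
    obtain ⟨Z, hZ, hZc⟩ := hZ₀c.exists_subset (Nat.sub_le k H.indepNum)
    obtain ⟨A₁, hA₁, hA₁c⟩ := exists_subset_card_eq (s := A') (n := H.indepNum) (by omega)
    exact ⟨A₁, hA₁.trans (hA'.trans hA), Z, hZ.trans (hZ₀.trans hY'), hA₁c, hZc.card_eq,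
      hosts_of_link hA₁c.ge hZc fun a ha z hz => h a (hA₁ ha) z (hZ₀ (hZ hz))⟩

/-- A nonempty set that extends to a copy of `H` by vertices of `U` outside any small set. -/
def IsCompletable (H : SimpleGraph V) (G : SimpleGraph α) (U : Finset α) (b : ℕ) (Y : Finset α) :
    Prop :=
  0 < Y.card ∧ Y.card ≤ Fintype.card V ∧ ∀ Q : Finset α, Q.card ≤ b →
    ∃ C ⊆ U, Disjoint C Q ∧ C.card + Y.card = Fintype.card V ∧ Hosts H G (Y ∪ C)

theorem isCompletable_singleton [Nonempty α] [Nonempty V] {U : Finset α} {b : ℕ}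
    (hU : NoClique Gᶜ (Fintype.card V) U) {w : α}
    (hw : 2 ^ (2 * Fintype.card V) + b ≤ (nbrs G U w).card) : IsCompletable H G U b {w} := by
  have hk : 0 < Fintype.card V := Fintype.card_pos
  refine ⟨by simp, by rw [card_singleton]; exact hk, fun Q hQ => ?_⟩
  have : 2 ^ (Fintype.card V - 1 + Fintype.card V) ≤ 2 ^ (2 * Fintype.card V) :=
    Nat.pow_le_pow_right (by norm_num) (by omega)
  obtain ⟨C, hC, hCc, hCQ⟩ := (hU.mono (nbrs_subset (G := G) (v := w))).exists_clique_disjoint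
    (Fintype.card V - 1) Q (by omega)
  refine ⟨C, hC.trans nbrs_subset, hCQ, by rw [hCc.card_eq, card_singleton]; omega,
    hosts_of_isNClique ?_⟩
  have := isNClique_union (SimpleGraph.isNClique_one.2 ⟨w, rfl⟩) hCc fun x hx y hy => by
    rw [mem_singleton.1 hx]
    exact (mem_nbrs.1 (hC hy)).2
  rwa [show 1 + (Fintype.card V - 1) = Fintype.card V by omega] at this

/-- No edge of H leaves `S`, so any clique of the missing size in `U` completes the copy, however it
is attached to `Y`. -/
theorem IsClosedPart.isCompletable [Nonempty α] {U Y : Finset α} {S : Finset V} {b : ℕ}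
    (hS : IsClosedPart H S) (hU : NoClique Gᶜ (Fintype.card V) U) (hYU : Disjoint Y U)
    (hY : HostsOn H G S Y) (hYc : Y.card = S.card)
    (hUc : 2 ^ (2 * Fintype.card V) + b ≤ U.card) : IsCompletable H G U b Y := by
  have h1 := hS.1.card_pos
  have h2 := card_le_univ S
  refine ⟨by omega, by omega, fun Q hQ => ?_⟩
  have : 2 ^ (Fintype.card V - S.card + Fintype.card V) ≤ 2 ^ (2 * Fintype.card V) :=
    Nat.pow_le_pow_right (by norm_num) (by omega)
  obtain ⟨C, hC, hCc, hCQ⟩ := hU.exists_clique_disjoint (Fintype.card V - S.card) Q (by omega)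
  exact ⟨C, hC, hCQ, by rw [hCc.card_eq]; omega, hS.hosts_union hY
    (hostsOn_of_isNClique hCc (by rw [card_compl])) (hYU.mono_right hC)⟩

/-- Completable sets covering `d` vertices outside the absorber save `d` vertices of it. -/
theorem pack_of_cover [Nonempty α] {U P W : Finset α} {m n d : ℕ} {F : Fin m → Finset α}
    (hUP : Disjoint U P) (hW : Disjoint W (U ∪ P))
    (habs : ∀ U' ⊆ U, ∀ j, Fintype.card V * j ≤ U'.card + P.card →
      Pack (G.IsNClique (Fintype.card V)) j (U' ∪ P))
    (hF : Pairwise fun i j => Disjoint (F i) (F j)) (hFW : ∀ i, F i ⊆ W)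
    (hFc : ∀ i, IsCompletable H G U (Fintype.card V * m) (F i)) (hd : d ≤ ∑ i, (F i).card)
    (hmn : m ≤ n) (hn : Fintype.card V * n ≤ U.card + P.card + d) :
    Pack (Hosts H G) n (W ∪ (U ∪ P)) := by
  obtain ⟨C, hC, hCd⟩ := exists_disjoint_family univ
    (fun i C => C ⊆ U ∧ C.card + (F i).card = Fintype.card V ∧ Hosts H G (F i ∪ C))
    (Fintype.card V) (by
      intro i _ Y hY
      rw [card_fin] at hY
      obtain ⟨C, hC, hCY, hCc, h⟩ := (hFc i).2.2 Y hY
      exact ⟨C, ⟨hC, hCc, h⟩, by omega, hCY⟩)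
  have hCd' : ∀ i j, i ≠ j → Disjoint (C i) (C j) := fun i j => hCd i (mem_univ _) j (mem_univ _)
  replace hC := fun i => hC i (mem_univ i)
  set D := univ.biUnion C with hD
  have hDU : D ⊆ U := biUnion_subset.2 fun i _ => (hC i).1
  have hDc : D.card = ∑ i, (C i).card := card_biUnion fun i _ j _ hij => hCd' i j hij
  -- The completions use only mk − ∑|F i| vertices of `U`, leaving enough for the absorber to supply
  -- the other n − m copies.
  have hsum : ∑ i, (C i).card + ∑ i, (F i).card = m * Fintype.card V := by
    rw [← sum_add_distrib, sum_congr rfl (fun i _ => (hC i).2.1)]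
    simp
  have h1 := card_sdiff_add_card_eq_card hDU
  obtain ⟨e, rfl⟩ := Nat.exists_eq_add_of_le hmn
  have hWU : Disjoint W U := hW.mono_right subset_union_left
  have p1 : Pack (Hosts H G) m (W ∪ D) := by
    have := pack_of_family (P := Hosts H G) (X := W ∪ D) univ (fun i => F i ∪ C i)
      (fun i _ j _ hij => ?_) fun i _ =>
        ⟨union_subset_union (hFW i) (subset_biUnion_of_mem C (mem_univ i)), (hC i).2.2⟩
    · simpa using this
    · rw [disjoint_union_left, disjoint_union_right, disjoint_union_right]
      exact ⟨⟨hF hij, hWU.mono (hFW i) (hC j).1⟩, (hWU.mono (hFW j) (hC i).1).symm,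
        hCd' i j hij⟩
  have p2 := (habs (U \ D) sdiff_subset e (by nlinarith)).imp (Q := Hosts H G)
    fun Y _ hY => ⟨Y, Subset.rfl, hosts_of_isNClique hY⟩
  refine (p1.union p2 ?_).mono_set (union_subset (union_subset_union Subset.rfl
    (hDU.trans subset_union_left)) ((union_subset_union sdiff_subset Subset.rfl).trans
      subset_union_right))
  rw [disjoint_union_left, disjoint_union_right (s := D)]
  exact ⟨hW.mono_right (union_subset_union sdiff_subset Subset.rfl), disjoint_sdiff,
    hUP.mono_left hDU⟩

/-- Cores whose vertices have few non-neighbours in `U` are completed to copies by vertices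
of `U`. -/
theorem pack_of_pack_core [Nonempty α] {U W : Finset α} {n T : ℕ} (hW : Disjoint W U)
    (hT : ∀ w ∈ W, (nbrs Gᶜ U w).card ≤ T)
    (hU : H.indepNum * n + H.indepNum + Fintype.card V * T ≤ U.card)
    (h : Pack (HostsCore H G) n W) : Pack (Hosts H G) n (W ∪ U) := by
  obtain ⟨F, hF, hF'⟩ := h.imp (Q := fun Y => HostsCore H G Y ∧
    Y.card ≤ Fintype.card V) fun Y _ hY => hY.exists_subset
  obtain ⟨C, hC, hCd⟩ := exists_disjoint_family univ
    (fun i C => C ⊆ U ∧ Hosts H G (F i ∪ C)) H.indepNum (by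
      intro i _ Y hY
      rw [card_fin] at hY
      have h1 : ((F i).biUnion (nbrs Gᶜ U)).card ≤ (F i).card * T :=
        card_biUnion_le_card_mul _ _ _ fun w hw => hT w ((hF' i).1 hw)
      have h2 : (F i).card * T ≤ Fintype.card V * T := Nat.mul_le_mul_right _ (hF' i).2.2
      have h3 := le_card_sdiff ((F i).biUnion (nbrs Gᶜ U) ∪ Y) U
      have h4 := card_union_le ((F i).biUnion (nbrs Gᶜ U)) Y
      obtain ⟨C, hC, hCc⟩ := exists_subset_card_eq
        (s := U \ ((F i).biUnion (nbrs Gᶜ U) ∪ Y)) (n := H.indepNum) (by omega)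
      obtain ⟨I, hI, hF⟩ := (hF' i).2.1
      refine ⟨C, ⟨hC.trans sdiff_subset, ?_⟩, hCc.le, ?_⟩
      · rw [union_comm]
        refine hosts_union_of_complete hI (hCc ▸ hI.card_le_indepNum) hF fun u hu w hw => ?_
        have hu' := hC hu
        rw [mem_sdiff, mem_union, mem_biUnion] at hu'
        by_contra huw
        refine hu'.2 (Or.inl ⟨w, hw, mem_nbrs.2 ⟨hu'.1, ?_⟩⟩)
        rw [SimpleGraph.compl_adj]
        exact ⟨fun h => disjoint_left.1 hW ((hF' i).1 hw) (h ▸ hu'.1), fun h => huw h.symm⟩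
      · exact disjoint_left.2 fun x hx hxY => (mem_sdiff.1 (hC hx)).2 (mem_union_right _ hxY))
  have := pack_of_family (P := Hosts H G) (X := W ∪ U) univ (fun i => F i ∪ C i)
    (fun i hi j hj hij => ?_) fun i hi =>
      ⟨union_subset_union (hF' i).1 (hC i hi).1, (hC i hi).2⟩
  · simpa using this
  · rw [disjoint_union_left, disjoint_union_right, disjoint_union_right]
    exact ⟨⟨hF hij, hW.mono (hF' i).1 (hC j hj).1⟩, (hW.mono (hF' j).1 (hC i hi).1).symm,
      hCd i hi j hj hij⟩

end

/-! ### Upper bound when one direction has no links -/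

section
open Classical Finset

variable {V α : Type*} [Fintype V] [DecidableEq α] {H : SimpleGraph V} {G : SimpleGraph α}

/-- Here |K| = (k + s)J with J = j + q^5. The main terms cancel, so only lower-order terms bound the
remainder `y`. -/
theorem le_pow_nine_of_excess {k s q j y : ℕ} (hs : 0 < s) (hsk : s ≤ k) (hkq : k ≤ q) (hq : 4 ≤ q)
    (h : s * y + (k + s) * (k * j) ≤
      k * (k * (j + q ^ 5) + s * (j + q ^ 5) + 1) + (k + s) * (2 * q ^ 5)) : y ≤ q ^ 9 := by
  have h1 : s * y ≤ (k + s) * (k + 2) * q ^ 5 + k := by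
    have : k * (k * (j + q ^ 5) + s * (j + q ^ 5) + 1) + (k + s) * (2 * q ^ 5) =
      (k + s) * (k * j) + ((k + s) * (k + 2) * q ^ 5 + k) := by ring
    omega
  have h2 : (k + s) * (k + 2) ≤ (2 * q) * (2 * q) := Nat.mul_le_mul (by omega) (by omega)
  have h3 : (k + s) * (k + 2) * q ^ 5 ≤ (2 * q) * (2 * q) * q ^ 5 := Nat.mul_le_mul_right _ h2
  have h4 : (2 * q) * (2 * q) * q ^ 5 = 4 * q ^ 7 := by ring
  have h5 : y ≤ s * y := Nat.le_mul_of_pos_left _ hs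
  have h6 : 4 * q ^ 7 ≤ q ^ 8 := by
    rw [pow_succ q 7, mul_comm]; exact Nat.mul_le_mul_left _ hq
  have h7 : 4 * q ^ 8 ≤ q ^ 9 := by
    rw [pow_succ q 8, mul_comm]; exact Nat.mul_le_mul_left _ hq
  have h8 : q ^ 1 ≤ q ^ 8 := Nat.pow_le_pow_right (by omega) (by norm_num)
  rw [pow_one] at h8
  omega

theorem pack_hosts_of_absorber [Nonempty V] [Nonempty α] (hH : ∀ v, ¬ H.IsIsolated v)
    {U P W : Finset α} {k q J e : ℕ} (hk : k = Fintype.card V) (hq : q = 2 ^ k) (hJ : J = q ^ 15)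
    (he : e ≤ q ^ 9 + 1) (hU : NoClique Gᶜ k U) (hUP : Disjoint U P) (hWd : Disjoint W (U ∪ P))
    (hUPc : U.card + P.card = k * J) (hPc : P.card ≤ q ^ 4)
    (habs : ∀ U' ⊆ U, ∀ j, k * j ≤ U'.card + P.card → Pack (G.IsNClique k) j (U' ∪ P))
    (hW : coreNumber H (J + e) + k * e ≤ W.card) :
    Pack (Hosts H G) (J + e) (W ∪ (U ∪ P)) ∨ Pack (Hosts H Gᶜ) (J + e) (W ∪ (U ∪ P)) := by
  have hi0 := indepNum_pos H
  have hi1 := indepNum_lt_card hH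
  obtain ⟨a, ha⟩ : ∃ a, a = H.indepNum := ⟨_, rfl⟩
  rw [← hk, ← ha] at hi1
  rw [← ha] at hi0
  have hq4 : 4 ≤ q := hq ▸ (Nat.pow_le_pow_right (by norm_num) (by omega) : 2 ^ 2 ≤ 2 ^ k)
  have hkq : k < q := hq ▸ Nat.lt_two_pow_self
  have hstep : ∀ i, 4 * q ^ i ≤ q ^ (i + 1) := fun i => by
    rw [pow_succ, mul_comm]; exact Nat.mul_le_mul_left _ hq4
  have hkstep : ∀ i, k * q ^ i ≤ q ^ (i + 1) := fun i => by
    rw [pow_succ, mul_comm]; exact Nat.mul_le_mul_left _ hkq.le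
  have hmono : ∀ i j, i ≤ j → q ^ i ≤ q ^ j := fun i j => Nat.pow_le_pow_right (by omega)
  have s2 := hmono 2 9 (by norm_num); have s4 := hmono 4 9 (by norm_num)
  have s9 := hstep 9; have s10 := hstep 10; have s11 := hstep 11; have s12 := hstep 12
  have s13 := hstep 13; have s14 := hstep 14
  have s1 := hmono 1 9 (by norm_num)
  have hk9 := hkstep 9; have hk13 := hkstep 13
  simp only [Nat.reduceAdd, pow_one] at s1 s9 s10 s11 s12 s13 s14 hk9 hk13
  have hke : k * e ≤ q ^ 11 := by
    have h1 := Nat.mul_le_mul_left k he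
    rw [mul_add, mul_one] at h1
    omega
  have hkke : k * (k * e) ≤ q ^ 12 := (Nat.mul_le_mul_left _ hke).trans (hkstep 11)
  have h2J : 2 * J ≤ k * J := Nat.mul_le_mul_right _ (by omega)
  have haJ : a * J + J ≤ k * J := by
    rw [← Nat.succ_mul]; exact Nat.mul_le_mul_right _ hi1
  have hWU : Disjoint W U := hWd.mono_right subset_union_left
  have h22 : 2 ^ (2 * k) = q ^ 2 := by rw [hq, ← pow_mul, mul_comm]
  have hUk : NoClique Gᶜ (Fintype.card V) U := hk ▸ hU
  -- The absorber has kJ vertices, so the extra `e` copies of G need ke vertices from `W`. At most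
  -- ke completable sets cover them, hence robustness k(ke) allows the completions to be chosen
  -- disjointly.
  rcases exists_cover_or_exists_free (P := IsCompletable H G U (k * (k * e))) (fun Y hY => hY.1)
    (k * e) W with ⟨m, hm, F, hF, hFW, hFc⟩ | ⟨W', hW', hW'c, hfree⟩
  · refine Or.inl (pack_of_cover (d := k * e) hUP hWd (hk ▸ habs) hF (fun i => (hFW i).1)
      (fun i => ?_) hFc (by omega) ?_)
    · refine ⟨(hFW i).2.1, (hFW i).2.2.1, fun Q hQ => (hFW i).2.2.2 Q (hQ.trans ?_)⟩
      rw [← hk]; exact Nat.mul_le_mul_left _ hm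
    · rw [← hk, hUPc, mul_add]
  · have hcf : ClosedPartFree H G W' := by
      intro S hS hSW
      obtain ⟨Z, hZ, hZc, hSZ⟩ := hSW.exists_subset
      refine hfree Z hZ (hS.isCompletable hUk (hWU.mono_left (hZ.trans hW')) hSZ hZc ?_)
      rw [← hk, h22]; omega
    -- A vertex with many G-neighbours in `U` would be completable alone. Thus `W'` is joined to `U`
    -- almost entirely in Gᶜ, and its Gᶜ-cores extend into `U`.
    have hnrich : ∀ w ∈ W', (nbrs G U w).card ≤ q ^ 13 := by
      intro w hw
      by_contra hlt
      refine hfree {w} (by simpa using hw) (isCompletable_singleton hUk ?_)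
      rw [← hk, h22]; omega
    have hpc : Pack (HostsCore H Gᶜ) (J + e) W' := by
      by_contra hnp
      have := (coreAvoiding_card hcf hnp).le_coreNumber hH
      omega
    refine Or.inr ((pack_of_pack_core (T := q ^ 13) (hWU.mono_left hW') ?_ ?_ hpc).mono_set
      (union_subset_union hW' subset_union_left))
    · rw [compl_compl]; exact hnrich
    · rw [← hk, ← ha, mul_add]
      have h1 : a * e ≤ k * e := Nat.mul_le_mul_right _ hi1.le
      omega

theorem pack_hosts_of_no_link [Nonempty V] [Nonempty α] (hH : ∀ v, ¬ H.IsIsolated v)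
    {X R B : Finset α} {n ω q : ℕ} (hq : q = 2 ^ Fintype.card V)
    (hcore : ∀ m, q ^ 14 ≤ m → coreNumber H m + 1 = (Fintype.card V - H.indepNum) * m + ω)
    (hω : (Fintype.card V + (Fintype.card V - H.indepNum)) * n + ω ≤ X.card + 1)
    (hRX : R ⊆ X) (hBX : B ⊆ X) (hd : Disjoint R B)
    (hR : NoClique Gᶜ (Fintype.card V) R) (hB : NoClique G (Fintype.card V) B)
    (hl : ∀ Y, ¬ IsLink H G R B Y) (hRc : q ^ 21 ≤ R.card) (hBc : q ^ 21 ≤ B.card) :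
    Pack (Hosts H G) n X ∨ Pack (Hosts H Gᶜ) n X := by
  by_contra hno
  rw [not_or] at hno
  have hi0 := indepNum_pos H
  have hi1 := indepNum_lt_card hH
  obtain ⟨k, hk⟩ : ∃ k, k = Fintype.card V := ⟨_, rfl⟩
  obtain ⟨a, ha⟩ : ∃ a, a = H.indepNum := ⟨_, rfl⟩
  obtain ⟨s, hs⟩ : ∃ s, s = k - a := ⟨_, rfl⟩
  rw [← hk, ← ha] at hi1
  rw [← ha] at hi0
  rw [← hk] at hq hR hB
  rw [← hk, ← ha, ← hs] at hω
  have hcore' : ∀ m, q ^ 14 ≤ m → coreNumber H m + 1 = s * m + ω := by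
    rw [hs, hk, ha]; exact hcore
  have hs0 : 0 < s := by omega
  have hq4 : 4 ≤ q := hq ▸ (Nat.pow_le_pow_right (by norm_num) (by omega) : 2 ^ 2 ≤ 2 ^ k)
  have hkq : k < q := hq ▸ Nat.lt_two_pow_self
  have hstep : ∀ i, 4 * q ^ i ≤ q ^ (i + 1) := fun i => by
    rw [pow_succ, mul_comm]; exact Nat.mul_le_mul_left _ hq4
  have hkstep : ∀ i, k * q ^ i ≤ q ^ (i + 1) := fun i => by
    rw [pow_succ, mul_comm]; exact Nat.mul_le_mul_left _ hkq.le
  have hq0 : ∀ i, 0 < q ^ i := fun i => by positivity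
  have hmono : ∀ i j, i ≤ j → q ^ i ≤ q ^ j := fun i j => Nat.pow_le_pow_right (by omega)
  obtain ⟨U₀, hU₀, P, hP, hUP₀, hPc, hUc₀, habs₀⟩ := exists_absorber_of_two_pow (G := G) (X := R)
    (a := k) (by omega) hq (by omega) le_rfl hR ((hmono 14 21 (by norm_num)).trans hRc)
  have hU16 : q ^ 16 ≤ U₀.card := by
    have : q ^ 5 * q ^ 16 ≤ q ^ 5 * U₀.card := by
      rw [← pow_add]; exact hRc.trans hUc₀
    exact Nat.le_of_mul_le_mul_left this (hq0 5)
  obtain ⟨J, hJ⟩ : ∃ J, J = q ^ 15 := ⟨_, rfl⟩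
  have s1 := hstep 1; have s2 := hstep 2; have s3 := hstep 3; have s4 := hstep 4
  have s5 := hstep 5; have s6 := hstep 6; have s7 := hstep 7; have s8 := hstep 8
  have s9 := hstep 9; have s10 := hstep 10; have s11 := hstep 11; have s12 := hstep 12
  have s13 := hstep 13; have s14 := hstep 14; have s15 := hstep 15
  simp only [Nat.reduceAdd, pow_one] at s1 s2 s3 s4 s5 s6 s7 s8 s9 s10 s11 s12 s13 s14 s15
  have hkJ : k * J ≤ q ^ 16 := hJ ▸ hkstep 15
  have h2J : 2 * J ≤ k * J := Nat.mul_le_mul_right _ (by omega)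
  -- Trimmed so that the absorber has exactly kJ vertices; with sJ vertices of `B` the set `K` has
  -- the exact bowtie density for J copies.
  obtain ⟨U, hU, hUc⟩ := exists_subset_card_eq (s := U₀) (n := k * J - P.card) (by omega)
  have hUR := hU.trans hU₀
  have hUPc : U.card + P.card = k * J := by omega
  have hUP := hUP₀.mono_left hU
  have habs : ∀ U' ⊆ U, ∀ j, k * j ≤ U'.card + P.card → Pack (G.IsNClique k) j (U' ∪ P) :=
    fun U' hU' => habs₀ U' (hU'.trans hU)
  have hsJ : s * J ≤ k * J := Nat.mul_le_mul_right _ (by omega)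
  obtain ⟨B₀, hB₀, hB₀c⟩ := exists_subset_card_eq (s := B) (n := s * J)
    (by have := hmono 16 21 (by norm_num); omega)
  have hUPR : U ∪ P ⊆ R := union_subset hUR hP
  have hUPB : Disjoint (U ∪ P) B₀ := hd.mono hUPR hB₀
  have hUB : Disjoint U B₀ := hUPB.mono_left subset_union_left
  obtain ⟨K, hK⟩ : ∃ K, K = U ∪ P ∪ B₀ := ⟨_, rfl⟩
  have hKc : K.card = k * J + s * J := by
    rw [hK, card_union_of_disjoint hUPB, card_union_of_disjoint hUP]; omega
  have hKX : K ⊆ X := hK ▸ union_subset (hUPR.trans hRX) (hB₀.trans hBX)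
  have hred : Pack (Hosts H G) J K := by
    refine ((habs U Subset.rfl J hUPc.ge).imp (Q := Hosts H G) fun Y _ hY =>
      ⟨Y, Subset.rfl, hosts_of_isNClique (hk ▸ hY)⟩).mono_set (hK ▸ subset_union_left)
  obtain ⟨j, hj⟩ : ∃ j, J = j + q ^ 5 := ⟨J - q ^ 5, by
    have := hmono 5 15 (by norm_num); omega⟩
  have haJ : a * J + J ≤ k * J := by
    rw [← Nat.succ_mul]; exact Nat.mul_le_mul_right _ hi1
  have hajJ : a * J = a * j + a * q ^ 5 := by rw [hj, mul_add]
  have hsjJ : s * J = s * j + s * q ^ 5 := by rw [hj, mul_add]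
  have hs5 : q ^ 5 ≤ s * q ^ 5 := Nat.le_mul_of_pos_left _ hs0
  -- Without links, Gᶜ-copies take α vertices in `U` and s in `B₀` until about q^5 copies short of
  -- J.
  have hblue : Pack (Hosts H Gᶜ) j K := by
    refine (pack_of_two_sides (a := a) (s := s) (c := q ^ 3) (d := 2 * q ^ 4)
      (fun U' hU' B' hB' h1 h2 => ?_) hUB (by omega) (by omega)).mono_set
      (hK ▸ union_subset_union subset_union_left Subset.rfl)
    rw [ha, hs, hk, ha]
    exact exists_hosts_of_no_link (hU'.trans hUR) (hB'.trans hB₀) hd (hk ▸ hR) (hk ▸ hB) hl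
      (by rw [← hk, ← hq]; exact h1) (by rw [← hk, ← hq]; exact h2)
  obtain ⟨Y, hY, n', hn', hnr, hnb, hYc⟩ := exists_bowtie_free_remainder (ω := ω) hKX hno.1 hno.2
    (by rw [← hk, ← ha, ← hs]; exact hω) (hred.of_le (by omega)) hblue
  rw [← hk, ← ha, ← hs] at hn' hYc
  have hJn : J < n' := by
    by_contra hle
    exact hnr ((hred.of_le (not_lt.1 hle)).mono_set subset_union_left)
  obtain ⟨e, he⟩ : ∃ e, n' = J + e := ⟨n' - J, by omega⟩
  have hYq : Y.card ≤ q ^ 9 := by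
    have h5 : 2 ^ (5 * k) = q ^ 5 := by rw [hq, ← pow_mul, mul_comm]
    rw [h5, hKc, hj] at hYc
    exact le_pow_nine_of_excess hs0 (by omega) hkq.le hq4 hYc
  have heq : e ≤ q ^ 9 + 1 := by
    have : (k + s) * e ≤ Y.card + 1 := by
      rw [he, hKc] at hn'
      have : (k + s) * (J + e) = k * J + s * J + (k + s) * e := by ring
      omega
    have := Nat.le_mul_of_pos_left e (show 0 < k + s by omega)
    omega
  obtain ⟨W, hW⟩ : ∃ W, W = B₀ ∪ Y := ⟨_, rfl⟩
  have hYK : Disjoint Y K := disjoint_sdiff_self_left.mono_left hY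
  have hWd : Disjoint W (U ∪ P) := by
    rw [hW, disjoint_union_left]
    exact ⟨hUPB.symm, hYK.mono_right (hK ▸ subset_union_left)⟩
  have hWc : W.card = s * J + Y.card := by
    rw [hW, card_union_of_disjoint (hYK.mono_right (hK ▸ subset_union_right)).symm, hB₀c]
  have hWK : W ∪ (U ∪ P) ⊆ K ∪ Y := by
    rw [hW, hK]
    refine union_subset (union_subset (subset_union_right.trans subset_union_left)
      subset_union_right) (subset_union_left.trans subset_union_left)
  have hn14 : q ^ 14 ≤ n' := by have := hmono 14 15 (by norm_num); omega
  -- The absorber takes kJ of the kn' vertices, so k(n' − J) = ke is left for `W` beyond the core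
  -- number.
  have hWcore : coreNumber H n' + k * e ≤ W.card := by
    have h1 := hcore' n' hn14
    have h2 : (k + s) * n' = k * J + k * e + s * n' := by rw [he]; ring
    omega
  rcases pack_hosts_of_absorber hH hk hq hJ heq (hR.mono hUR) hUP hWd hUPc hPc habs (he ▸ hWcore)
    with h | h
  · exact hnr (he ▸ h.mono_set hWK)
  · exact hnb (he ▸ h.mono_set hWK)

/-- Disjoint links yield as many disjoint copies, together with a reserve of vertices in `B`. -/
theorem exists_reserve_of_pack_link [Nonempty α] {R B X : Finset α} {x : ℕ}
    (h : Pack (IsLink H G R B) x X) :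
    ∃ K ⊆ X, K.card = Fintype.card V * x ∧ Pack (Hosts H G) x K ∧
      ∃ D ⊆ K, D ⊆ B ∧ D.card = H.indepNum * x := by
  obtain ⟨F, hF, hF'⟩ := h
  choose hFX A hA Z hZ hAc hZc hAZ hFAZ using hF'
  refine ⟨univ.biUnion F, biUnion_subset.2 fun i _ => hFX i, ?_, ?_, univ.biUnion Z, ?_, ?_, ?_⟩
  · rw [card_biUnion fun i _ j _ hij => hF hij, sum_congr rfl (fun i _ =>
      IsLink.card_eq ⟨A i, hA i, Z i, hZ i, hAc i, hZc i, hAZ i, hFAZ i⟩)]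
    simp [mul_comm]
  · refine ⟨F, hF, fun i => ⟨subset_biUnion_of_mem F (mem_univ i), ?_⟩⟩
    rw [hFAZ, union_comm]
    exact hosts_of_link (hZc i).ge (hAc i) fun z hz a ha => (hAZ i a ha z hz).symm
  · exact biUnion_mono fun i _ => by rw [hFAZ]; exact subset_union_right
  · exact biUnion_subset.2 fun i _ => hZ i
  · have hZF : ∀ i, Z i ⊆ F i := fun i => by rw [hFAZ]; exact subset_union_right
    rw [card_biUnion fun i _ j _ hij => (hF hij).mono (hZF i) (hZF j),
      sum_congr rfl (fun i _ => hZc i)]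
    simp [mul_comm]

end

/-! ### Upper bound: reduction to a missing link direction -/

section
open Classical Finset

variable {V α : Type*} [Fintype V] [DecidableEq α] {H : SimpleGraph V} {G : SimpleGraph α}

/-- With x links each way, `K` has 2kx vertices and about x + ax/k copies in each colour. Since (k +
s)(k + a) = 2k² + sa, this beats the bowtie rate by a term s·a·x, which the error terms force to be
small. -/
theorem lt_pow_eight_of_reserve {k s a q j x y : ℕ} (hk : k = s + a) (hs : 0 < s) (ha : 0 < a)
    (hkq : k ≤ q) (hq : 4 ≤ q) (hj : a * x ≤ k * j + q ^ 2 + k)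
    (h : s * y + (k + s) * (k * (x + j)) ≤ k * (2 * (k * x) + 1) + (k + s) * (2 * q ^ 5)) :
    x < q ^ 8 := by
  have h1 : (k + s) * (a * x) ≤ (k + s) * (k * j + q ^ 2 + k) := Nat.mul_le_mul_left _ hj
  have h2 : s * a * x ≤ k + (k + s) * (2 * q ^ 5 + q ^ 2 + k) := by
    have e1 : (k + s) * (k * (x + j)) + (k + s) * (a * x) =
        2 * (k * (k * x)) + s * a * x + (k + s) * (k * j) := by rw [hk]; ring
    have e2 : (k + s) * (k * j + q ^ 2 + k) = (k + s) * (k * j) + (k + s) * (q ^ 2 + k) := by ring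
    have e3 : k * (2 * (k * x) + 1) = 2 * (k * (k * x)) + k := by ring
    have e4 : (k + s) * (2 * q ^ 5 + q ^ 2 + k) = (k + s) * (2 * q ^ 5) + (k + s) * (q ^ 2 + k) := by
      ring
    omega
  have h3 : x ≤ s * a * x := Nat.le_mul_of_pos_left _ (Nat.mul_pos hs ha)
  have hstep : ∀ i, 4 * q ^ i ≤ q ^ (i + 1) := fun i => by
    rw [pow_succ, mul_comm]; exact Nat.mul_le_mul_left _ hq
  have hmono : ∀ i, i ≤ 5 → q ^ i ≤ q ^ 5 := fun i => Nat.pow_le_pow_right (by omega)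
  have m1 := hmono 1 (by norm_num); have m2 := hmono 2 (by norm_num)
  have s5 := hstep 5; have s6 := hstep 6; have s7 := hstep 7
  have h5 : 0 < q ^ 5 := by positivity
  rw [pow_one] at m1
  have h4 : (k + s) * (2 * q ^ 5 + q ^ 2 + k) ≤ (2 * q) * (4 * q ^ 5) :=
    Nat.mul_le_mul (by omega) (by omega)
  have h6 : (2 * q) * (4 * q ^ 5) = 8 * q ^ 6 := by ring
  simp only [Nat.reduceAdd] at s5 s6 s7
  omega

theorem card_le_card_inter_add {R T Y : Finset α} {c : ℕ} (hR : R ⊆ T) (hY : Y ⊆ T)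
    (h : T.card ≤ Y.card + c) : R.card ≤ (R ∩ Y).card + c := by
  have h1 := card_inter_add_card_sdiff R Y
  have h2 := card_sdiff_add_card_eq_card hY
  have h3 := card_le_card (sdiff_subset_sdiff hR (Subset.refl Y))
  omega

theorem pack_hosts_of_card [Nonempty V] [Nonempty α] (hH : ∀ v, ¬ H.IsIsolated v)
    {X : Finset α} {n ω q : ℕ} (hq : q = 2 ^ Fintype.card V) (hn : q ^ 24 ≤ n)
    (hcore : ∀ m, q ^ 14 ≤ m → coreNumber H m + 1 = (Fintype.card V - H.indepNum) * m + ω)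
    (hω : (Fintype.card V + (Fintype.card V - H.indepNum)) * n + ω ≤ X.card + 1) :
    Pack (Hosts H G) n X ∨ Pack (Hosts H Gᶜ) n X := by
  by_contra hno
  have hno' := hno
  rw [not_or] at hno'
  have hi0 := indepNum_pos H
  have hi1 := indepNum_lt_card hH
  obtain ⟨k, hk⟩ : ∃ k, k = Fintype.card V := ⟨_, rfl⟩
  have hq4 : 4 ≤ q := hq ▸
    (Nat.pow_le_pow_right (by norm_num) (by omega) : 2 ^ 2 ≤ 2 ^ Fintype.card V)
  have hkq : k < q := hq ▸ hk ▸ Nat.lt_two_pow_self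
  have h22 : 2 ^ (k + k) = q ^ 2 := by rw [hq, hk, ← pow_mul, mul_two]
  have hmono : ∀ i j, i ≤ j → q ^ i ≤ q ^ j := fun i j => Nat.pow_le_pow_right (by omega)
  have hk8 : k * q ^ 8 ≤ q ^ 9 := by
    rw [pow_succ q 8, mul_comm]; exact Nat.mul_le_mul_left _ hkq.le
  have hkX : k * n + n ≤ X.card + 1 := by
    rw [← hk, add_mul] at hω
    have := Nat.le_mul_of_pos_left n (Nat.sub_pos_of_lt hi1)
    rw [← hk] at this
    omega
  have hleft : ∀ G : SimpleGraph α, ¬ Pack (Hosts H G) n X →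
      ∃ R ⊆ X, NoClique G k R ∧ n ≤ R.card := by
    intro G hG
    obtain ⟨j, R, hR, hRc, hpack, hcard⟩ := exists_pack_leftover k (by omega)
      (P := G.IsNClique k) (fun Y hY => hY.card_eq) X
    refine ⟨R, hR, hRc, ?_⟩
    have hjn : j < n := by
      by_contra hle
      exact hG (((hpack.imp fun Y _ hY => ⟨Y, Subset.rfl, hosts_of_isNClique (hk ▸ hY)⟩).of_le
        (not_lt.1 hle)).mono_set sdiff_subset)
    have : k * j + k ≤ k * n := by rw [← Nat.mul_succ]; exact Nat.mul_le_mul_left _ hjn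
    omega
  obtain ⟨R, hRX, hR, hRc⟩ := hleft Gᶜ hno'.2
  obtain ⟨B₁, hB₁X, hB₁, hB₁c⟩ := hleft G hno'.1
  obtain ⟨B, hBdef⟩ : ∃ B, B = B₁ \ R := ⟨_, rfl⟩
  have hRB : Disjoint R B := hBdef ▸ disjoint_sdiff
  have hBX : B ⊆ X := hBdef ▸ sdiff_subset.trans hB₁X
  have hB : NoClique G k B := hB₁.mono (hBdef ▸ sdiff_subset)
  -- `R` and `B₁` share fewer than q^2 vertices: the intersection has no k-clique in either colour.
  have hBc : n ≤ B.card + q ^ 2 := by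
    have h1 := card_inter_add_card_sdiff B₁ R
    have h2 : (B₁ ∩ R).card < q ^ 2 := by
      by_contra hle
      obtain ⟨A, hA, hA'⟩ := (hR.mono (inter_subset_right (s₁ := B₁))).exists_clique k
        (by rw [h22]; exact not_lt.1 hle)
      exact hB₁ A (hA.trans inter_subset_left) hA'
    rw [hBdef]
    omega
  have hm : q ^ 21 + 2 * q ^ 9 + q ^ 2 ≤ q ^ 24 := by
    have h1 : 4 * q ^ 23 ≤ q ^ 24 := by
      rw [pow_succ q 23, mul_comm]; exact Nat.mul_le_mul_left _ hq4
    have := hmono 21 23 (by norm_num); have := hmono 9 23 (by norm_num)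
    have := hmono 2 23 (by norm_num)
    omega
  have hR' := hR
  have hB' := hB
  rw [hk] at hR' hB'
  rcases pack_or_exists_free k (fun Y hY => (IsLink.card_eq (H := H) hY).trans_le hk.ge)
    (q ^ 8) (R ∪ B) (P := IsLink H G R B) with hp | ⟨Y, hY, hYc, hfree⟩
  swap
  · have h1 := card_le_card_inter_add subset_union_left hY hYc
    have h2 := card_le_card_inter_add subset_union_right hY hYc
    have h3 : q ^ 21 ≤ (R ∩ Y).card := by omega
    have h4 : q ^ 21 ≤ (B ∩ Y).card := by omega
    refine hno (pack_hosts_of_no_link hH hq hcore hω (inter_subset_left.trans hRX)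
      (inter_subset_left.trans hBX) (hRB.mono inter_subset_left inter_subset_left)
      (hR'.mono inter_subset_left) (hB'.mono inter_subset_left) (fun Z hZ => ?_) h3 h4)
    exact hfree Z (hZ.subset.trans (union_subset inter_subset_right inter_subset_right))
      (hZ.mono inter_subset_left inter_subset_left)
  obtain ⟨K₁, hK₁, hK₁c, hK₁p, D₁, hD₁, hD₁B, hD₁c⟩ := exists_reserve_of_pack_link hp
  rw [← hk] at hK₁c
  rcases pack_or_exists_free k (fun Y hY => (IsLink.card_eq (H := H) hY).trans_le hk.ge)
    (q ^ 8) ((R ∪ B) \ K₁) (P := IsLink H Gᶜ B R) with hp | ⟨Y, hY, hYc, hfree⟩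
  swap
  · have hc := card_sdiff_add_card_eq_card hK₁
    have hY' := hY.trans sdiff_subset
    have hYc' : (R ∪ B).card ≤ Y.card + (k * q ^ 8 + k * q ^ 8) := by omega
    have h1 := card_le_card_inter_add subset_union_left hY' hYc'
    have h2 := card_le_card_inter_add subset_union_right hY' hYc'
    have h3 : q ^ 21 ≤ (R ∩ Y).card := by omega
    have h4 : q ^ 21 ≤ (B ∩ Y).card := by omega
    refine hno (Or.symm ?_)
    have := pack_hosts_of_no_link (G := Gᶜ) hH hq hcore hω (inter_subset_left.trans hBX)
      (inter_subset_left.trans hRX) (hRB.symm.mono inter_subset_left inter_subset_left)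
      (hB'.mono (inter_subset_left (s₂ := Y))).of_compl_compl
      (hR'.mono (inter_subset_left (s₂ := Y))) (fun Z hZ => ?_) h4 h3
    · rwa [compl_compl] at this
    · exact hfree Z (hZ.subset.trans (union_subset inter_subset_right inter_subset_right))
        (hZ.mono inter_subset_left inter_subset_left)
  obtain ⟨K₂, hK₂, hK₂c, hK₂p, D₂, hD₂, hD₂R, hD₂c⟩ := exists_reserve_of_pack_link hp
  rw [← hk] at hK₂c
  have hKd : Disjoint K₁ K₂ := disjoint_sdiff.mono_right hK₂
  have hKX : K₁ ∪ K₂ ⊆ X := union_subset (hK₁.trans (union_subset hRX hBX))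
    (hK₂.trans (sdiff_subset.trans (union_subset hRX hBX)))
  obtain ⟨a, ha⟩ : ∃ a, a = H.indepNum := ⟨_, rfl⟩
  rw [← ha] at hD₁c hD₂c hi0 hi1
  rw [← hk] at hi1
  have hax : q ^ 2 ≤ a * q ^ 8 :=
    (hmono 2 8 (by norm_num)).trans (Nat.le_mul_of_pos_left _ hi0)
  -- Each link family contains a reserve of a·q^8 vertices in the side rich in cliques of the other
  -- colour; all but fewer than q^2 + k of these vertices pack into `j` further copies.
  obtain ⟨j, hj⟩ : ∃ j, j = (a * q ^ 8 - q ^ 2) / k := ⟨_, rfl⟩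
  have hj1 : k * j ≤ a * q ^ 8 - q ^ 2 := hj ▸ Nat.mul_div_le _ _
  have hj2 : a * q ^ 8 - q ^ 2 < k * (j + 1) := hj ▸ Nat.lt_mul_div_succ _ (by omega)
  rw [mul_add, mul_one] at hj2
  have hred : Pack (Hosts H G) (q ^ 8 + j) (K₁ ∪ K₂) := by
    refine hK₁p.union (((hR.mono hD₂R).pack (by omega) (j := j) ?_).mono_set hD₂ |>.imp
      fun Y _ hY => ⟨Y, Subset.rfl, hosts_of_isNClique (hk ▸ hY)⟩) hKd
    rw [h22]; omega
  have hblue : Pack (Hosts H Gᶜ) (q ^ 8 + j) (K₁ ∪ K₂) := by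
    rw [union_comm]
    refine hK₂p.union ((NoClique.pack (G := Gᶜ) (hB.mono hD₁B).of_compl_compl (a := k) (by omega)
      (j := j) ?_).mono_set hD₁ |>.imp
      fun Y _ hY => ⟨Y, Subset.rfl, hosts_of_isNClique (hk ▸ hY)⟩) hKd.symm
    rw [h22]; omega
  obtain ⟨Y, -, n', -, -, -, hYc⟩ := exists_bowtie_free_remainder hKX hno'.1 hno'.2 hω hred hblue
  have h5 : 2 ^ (5 * k) = q ^ 5 := by rw [hq, hk, ← pow_mul, mul_comm]
  rw [← hk, ← ha, card_union_of_disjoint hKd, hK₁c, hK₂c, h5, ← two_mul] at hYc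
  exact lt_irrefl _ (lt_pow_eight_of_reserve (by omega) (Nat.sub_pos_of_lt hi1) hi0 hkq.le hq4
    (by omega) hYc)

end

/-! ### Translation to Ramsey numbers and the lower bound -/

section
open Classical Finset

variable {V α β : Type*} [Fintype V] [DecidableEq α] [DecidableEq β] {H : SimpleGraph V}
  {G : SimpleGraph α}

theorem isContained_copies_iff [Fintype α] {n : ℕ} :
    (copies n H).IsContained G ↔ Pack (Hosts H G) n univ := by
  constructor
  · rintro ⟨f⟩
    refine ⟨fun i => univ.image fun v => f (i, v), fun i j hij => ?_, fun i => ⟨subset_univ _,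
      fun v => f (i, v), fun v _ w _ hvw => ?_, fun v _ => mem_image_of_mem _ (mem_univ v),
      fun v _ w _ hvw => f.toHom.map_rel ⟨rfl, hvw⟩⟩⟩
    · refine disjoint_left.2 fun x hx hx' => ?_
      obtain ⟨v, -, rfl⟩ := mem_image.1 hx
      obtain ⟨w, -, hw⟩ := mem_image.1 hx'
      exact hij (congrArg Prod.fst (f.injective hw)).symm
    · exact congrArg Prod.snd (f.injective hvw)
  · rintro ⟨F, hF, hF'⟩
    choose f hinj hmem hadj using fun i => (hF' i).2
    refine ⟨⟨⟨fun x => f x.1 x.2, ?_⟩, ?_⟩⟩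
    · rintro ⟨i, v⟩ ⟨j, w⟩ ⟨h, hvw⟩
      obtain rfl : i = j := h
      exact hadj i v (mem_univ _) w (mem_univ _) hvw
    · rintro ⟨i, v⟩ ⟨j, w⟩ h
      replace h : f i v = f j w := h
      by_cases hij : i = j
      · subst hij
        exact Prod.ext rfl (hinj i (by simp) (by simp) h)
      · exact (disjoint_left.1 (hF hij) (hmem i v (mem_univ _))
          (h ▸ hmem j w (mem_univ _))).elim

theorem ramseyProperty_copies_iff {N n : ℕ} :
    RamseyProperty N (copies n H) ↔
      ∀ G : SimpleGraph (Fin N), Pack (Hosts H G) n univ ∨ Pack (Hosts H Gᶜ) n univ := by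
  constructor
  · intro h G
    obtain ⟨i, hi⟩ := h G.toTopEdgeLabeling
    rw [isContained_copies_iff] at hi
    fin_cases i
    · right
      rw [← SimpleGraph.toTopEdgeLabeling_labelGraph_compl]
      exact hi
    · left
      rw [← SimpleGraph.toTopEdgeLabeling_labelGraph G]
      exact hi
  · intro h χ
    obtain ⟨G, rfl⟩ : ∃ G : SimpleGraph (Fin N), χ = G.toTopEdgeLabeling :=
      ⟨χ.labelGraph 1, by convert χ.labelGraph_toTopEdgeLabeling.symm⟩
    rcases h G with h | h
    · refine ⟨1, ?_⟩
      rw [isContained_copies_iff, SimpleGraph.toTopEdgeLabeling_labelGraph]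
      exact h
    · refine ⟨0, ?_⟩
      rw [isContained_copies_iff, SimpleGraph.toTopEdgeLabeling_labelGraph_compl]
      exact h

/-- The vertices of a copy that fall outside the clique form a closed part of H, unless there are
none. -/
theorem not_pack_hosts_sum {m n : ℕ} [Fintype β] {G : SimpleGraph β}
    (hG : ClosedPartFree H G univ) (hm : m < Fintype.card V * n) :
    ¬ Pack (Hosts H ((⊤ : SimpleGraph (Fin m)) ⊕g G)) n univ := by
  rintro ⟨F, hF, hF'⟩
  have hpack : Pack (fun Y => Fintype.card V ≤ Y.card) n (univ : Finset (Fin m)) := by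
    refine ⟨fun i => (F i).toLeft, fun i j hij => disjoint_left.2 fun x hx hx' =>
      disjoint_left.1 (hF hij) (mem_toLeft.1 hx) (mem_toLeft.1 hx'), fun i => ⟨subset_univ _, ?_⟩⟩
    obtain ⟨f, h1, h2, h3⟩ := (hF' i).2
    have hleft : ∀ v, (f v).isLeft := by
      by_contra hne
      rw [not_forall] at hne
      obtain ⟨v₀, hv₀⟩ := hne
      obtain ⟨b₀, hb₀⟩ := Sum.isRight_iff.1 (by simpa using hv₀)
      have hS : ∀ v, v ∈ univ.filter (fun v => (f v).isRight) → ∃ b, f v = .inr b :=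
        fun v hv => Sum.isRight_iff.1 (by simpa using hv)
      refine hG (univ.filter (fun v => (f v).isRight)) ⟨⟨v₀, by simp [hb₀]⟩, ?_⟩
        ⟨fun v => Sum.elim (fun _ => b₀) id (f v), ?_, fun _ _ => mem_univ _, ?_⟩
      · intro v hv w hw hvw
        obtain ⟨b, hb⟩ := hS v hv
        obtain ⟨a, ha⟩ := Sum.isLeft_iff.1 (show (f w).isLeft by simpa using hw)
        have := h3 v (mem_univ _) w (mem_univ _) hvw
        simp [ha, hb] at this
      · intro v hv w hw hvw
        obtain ⟨b, hb⟩ := hS v hv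
        obtain ⟨b', hb'⟩ := hS w hw
        simp only [hb, hb', Sum.elim_inr, id] at hvw
        exact h1 (by simp) (by simp) (by rw [hb, hb', hvw])
      · intro v hv w hw hvw
        obtain ⟨b, hb⟩ := hS v hv
        obtain ⟨b', hb'⟩ := hS w hw
        have := h3 v (mem_univ _) w (mem_univ _) hvw
        simpa [hb, hb'] using this
    rw [← card_univ, ← card_map (s := (F i).toLeft) .inl]
    refine card_le_card_of_injOn f (fun v _ => ?_) h1
    obtain ⟨a, ha⟩ := Sum.isLeft_iff.1 (hleft v)
    have := h2 v (mem_univ _)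
    simpa [ha] using this
  have := hpack.mul_le_card fun Y hY => hY
  simp at this
  omega

/-- The clique becomes independent in the complement, so the part of a copy outside it is a core. -/
theorem not_pack_hosts_compl_sum [Nonempty β] {m n : ℕ} [Fintype β] {G : SimpleGraph β}
    (hG : ¬ Pack (HostsCore H Gᶜ) n univ) :
    ¬ Pack (Hosts H ((⊤ : SimpleGraph (Fin m)) ⊕g G)ᶜ) n univ := by
  rintro ⟨F, hF, hF'⟩
  refine hG ⟨fun i => (F i).toRight, fun i j hij => disjoint_left.2 fun x hx hx' =>
      disjoint_left.1 (hF hij) (mem_toRight.1 hx) (mem_toRight.1 hx'), fun i => ⟨subset_univ _, ?_⟩⟩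
  obtain ⟨f, h1, h2, h3⟩ := (hF' i).2
  refine ⟨univ.filter (fun v => (f v).isLeft), ?_, ?_⟩
  · intro v hv w hw _ hvw
    obtain ⟨a, ha⟩ := Sum.isLeft_iff.1 (show (f v).isLeft by simpa using hv)
    obtain ⟨b, hb⟩ := Sum.isLeft_iff.1 (show (f w).isLeft by simpa using hw)
    have := h3 v (mem_univ _) w (mem_univ _) hvw
    rw [SimpleGraph.compl_adj] at this
    simp [ha, hb] at this
  · have hS : ∀ v, v ∈ (univ.filter (fun v => (f v).isLeft))ᶜ → ∃ b, f v = .inr b :=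
      fun v hv => Sum.isRight_iff.1 (by simpa using hv)
    obtain ⟨b₀⟩ := ‹Nonempty β›
    refine ⟨fun v => Sum.elim (fun _ => b₀) id (f v), ?_, ?_, ?_⟩
    · intro v hv w hw hvw
      obtain ⟨b, hb⟩ := hS v hv
      obtain ⟨b', hb'⟩ := hS w hw
      simp only [hb, hb', Sum.elim_inr, id] at hvw
      exact h1 (by simp) (by simp) (by rw [hb, hb', hvw])
    · intro v hv
      obtain ⟨b, hb⟩ := hS v hv
      have := h2 v (mem_univ _)
      rw [hb] at this
      simpa [hb] using this
    · intro v hv w hw hvw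
      obtain ⟨b, hb⟩ := hS v hv
      obtain ⟨b', hb'⟩ := hS w hw
      have := h3 v (mem_univ _) w (mem_univ _) hvw
      rw [SimpleGraph.compl_adj] at this ⊢
      simpa [hb, hb'] using this

theorem not_ramseyProperty_copies [Nonempty V] {n x N : ℕ} (h : CoreAvoiding H n x)
    (hx : 0 < x) (hN : N < Fintype.card V * n + x) : ¬ RamseyProperty N (copies n H) := by
  rw [ramseyProperty_copies_iff]
  obtain ⟨G, h1, h2⟩ := h
  have : Nonempty (Fin x) := ⟨⟨0, hx⟩⟩
  intro hR
  have hn : 0 < n := by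
    rcases Nat.eq_zero_or_pos n with rfl | hn
    · exact (h2 Pack.zero).elim
    · exact hn
  have hkn : 0 < Fintype.card V * n := Nat.mul_pos Fintype.card_pos hn
  -- Every smaller N must fail as well, so the colouring is restricted along an embedding.
  obtain ⟨φ⟩ : Nonempty (Fin N ↪ Fin (Fintype.card V * n - 1) ⊕ Fin x) :=
    Function.Embedding.nonempty_of_card_le (by simp; omega)
  rcases hR (((⊤ : SimpleGraph (Fin (Fintype.card V * n - 1))) ⊕g G).comap φ) with h | h
  · exact not_pack_hosts_sum h1 (by omega) ((h.map φ.injective fun Y hY =>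
      HostsOn.map φ.injective (fun _ _ hab => hab) hY).mono_set (subset_univ _))
  · refine not_pack_hosts_compl_sum h2 ((h.map φ.injective fun Y hY =>
      HostsOn.map φ.injective (fun a b hab => ?_) hY).mono_set (subset_univ _))
    rw [SimpleGraph.compl_adj] at hab ⊢
    exact ⟨φ.injective.ne hab.1, hab.2⟩

theorem exists_coreNumber_eq [Nonempty V] (hH : ∀ v, ¬ H.IsIsolated v) :
    ∃ ω, ∀ m, (2 ^ Fintype.card V) ^ 14 ≤ m →
      coreNumber H m + 1 = (Fintype.card V - H.indepNum) * m + ω := by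
  obtain ⟨m₀, hm₀⟩ : ∃ m₀, m₀ = (2 ^ Fintype.card V) ^ 14 := ⟨_, rfl⟩
  have h0 : 0 < m₀ := by rw [hm₀]; positivity
  have hpos := Nat.mul_pos (Nat.sub_pos_of_lt (indepNum_lt_card hH)) h0
  have hle := (coreAvoiding_of_lt hH (n := m₀) (Nat.sub_lt hpos one_pos)).le_coreNumber hH
  rw [← hm₀]
  -- The + 1 keeps the subtraction from truncating: `coreNumber H m₀` is at least s·m₀ − 1.
  refine ⟨coreNumber H m₀ + 1 - (Fintype.card V - H.indepNum) * m₀, fun m hm => ?_⟩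
  induction m, hm using Nat.le_induction with
  | base => omega
  | succ m hm ih => rw [coreNumber_succ hH (hm₀ ▸ hm), mul_add, mul_one]; omega

theorem ramseyNumber_copies [Nonempty V] (hH : ∀ v, ¬ H.IsIsolated v) {n : ℕ}
    (hn : (2 ^ Fintype.card V) ^ 24 ≤ n) :
    ramseyNumber (copies n H) = Fintype.card V * n + coreNumber H n := by
  have hn0 : 0 < n := lt_of_lt_of_le (by positivity) hn
  have hs := Nat.sub_pos_of_lt (indepNum_lt_card hH)
  obtain ⟨ω, hω⟩ := exists_coreNumber_eq hH
  have hn14 : (2 ^ Fintype.card V) ^ 14 ≤ n :=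
    (Nat.pow_le_pow_right (by positivity) (by norm_num)).trans hn
  have hkn := Nat.mul_pos (Fintype.card_pos (α := V)) hn0
  have hup : RamseyProperty (Fintype.card V * n + coreNumber H n) (copies n H) := by
    rw [ramseyProperty_copies_iff]
    intro G
    have : Nonempty (Fin (Fintype.card V * n + coreNumber H n)) := ⟨⟨0, by omega⟩⟩
    refine pack_hosts_of_card hH rfl hn hω ?_
    have := hω n hn14
    rw [card_univ, Fintype.card_fin, add_mul]
    omega
  have hpos : 0 < coreNumber H n := by
    have h1 := hω n hn14
    have h2 := Nat.le_mul_of_pos_left n hs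
    have h3 : 2 ^ 1 ≤ (2 ^ Fintype.card V) ^ 24 := by
      rw [← pow_mul]
      exact Nat.pow_le_pow_right (by norm_num) (Nat.mul_pos Fintype.card_pos (by norm_num))
    omega
  refine le_antisymm (Nat.sInf_le hup) (le_csInf ⟨_, hup⟩ fun N hN => ?_)
  by_contra hlt
  exact not_ramseyProperty_copies (coreAvoiding_coreNumber hH hn0) hpos (not_le.1 hlt) hN

end

theorem theorem1p2 :
    ∃ C : ℝ, 0 < C ∧
      ∀ (V : Type*) [Fintype V] (H : SimpleGraph V), (∀ v : V, ¬ H.IsIsolated v) →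
        ∃ c : ℤ, ∀ n : ℕ, (2 : ℝ) ^ (C * (Fintype.card V : ℝ)) ≤ (n : ℝ) →
          (ramseyNumber (copies n H) : ℤ) =
            (2 * (Fintype.card V : ℤ) - (H.indepNum : ℤ)) * (n : ℤ) + c := by
  refine ⟨24, by norm_num, fun V _ H hH => ?_⟩
  rcases isEmpty_or_nonempty V with hV | hV
  · refine ⟨0, fun n _ => ?_⟩
    have h1 : H.indepNum = 0 := by
      have := indepNum_le_card H
      rwa [Fintype.card_eq_zero, Nat.le_zero] at this
    have h2 : ramseyNumber (copies n H) = 0 :=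
      Nat.le_zero.1 (Nat.sInf_le fun χ =>
        ⟨0, ⟨⟨⟨fun x => isEmptyElim x, fun {x} => isEmptyElim x⟩, fun x => isEmptyElim x⟩⟩⟩)
    simp [h1, h2]
  · obtain ⟨ω, hω⟩ := exists_coreNumber_eq hH
    refine ⟨(ω : ℤ) - 1, fun n hn => ?_⟩
    have hn24 : (2 ^ Fintype.card V) ^ 24 ≤ n := by
      have h : (2 : ℝ) ^ ((24 : ℝ) * (Fintype.card V : ℝ)) =
          ((2 ^ (24 * Fintype.card V) : ℕ) : ℝ) := by
        rw [← Nat.cast_ofNat (n := 24), ← Nat.cast_mul, Real.rpow_natCast]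
        push_cast
        rfl
      rw [h] at hn
      rw [← pow_mul, mul_comm]
      exact_mod_cast hn
    rw [ramseyNumber_copies hH hn24]
    have h1 := hω n ((Nat.pow_le_pow_right (by positivity) (by norm_num)).trans hn24)
    have h2 := (indepNum_lt_card hH).le
    zify [h2] at h1
    push_cast
    linarith
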